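/- Let $(a_n)_{n\ge 0}$ be complex numbers with $a_0\neq 0$ such that the series $\sum_{n\ge 0}a_nz^n$ converges for every $z\in\mathbb C$ and its sum is a non-constant (entire) function, and let $\varepsilon\in(0,\tfrac12)$. For $r>0$ put $$S(r)=2\sum_{n\ge 0}\log^+\bigl(|a_n|r^n\bigr),\qquad \log^+x=\max(\log x,0),\quad \log^+0=0 .$$ Then there is a (non-random) measurable set $E\subset[1,\infty)$ of finite logarithmic measure, i.e. $\int_E\frac{dt}{t}<\infty$, depending only on $(a_n)$ and $\varepsilon$, with the following property. Let $\xi_0,\xi_1,\dots$ be independent standard complex Gaussian random variables (each with density $\frac1\pi e^{-|z|^2}$ with respect to Lebesgue measure on $\mathbb C$), defined on any probability space. Then almost surely the series $$f(z)=\sum_{n\ge 0}a_n\xi_nz^n$$ converges for every $z\in\mathbb C$, and $$-\log \mathbb P\bigl(f(z)\neq 0\text{ for all }|z|\le r\bigr)=S(r)+O\bigl(S(r)^{1/2+\varepsilon}\bigr)\qquad\text{as } r\to\infty,\ r\notin E .$$ -/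

import Mathlib

open MeasureTheory ProbabilityTheory Filter Asymptotics

/-- The standard complex Gaussian distribution: density `π⁻¹ * exp (-|z|²)` with respect to
Lebesgue measure on the complex plane. -/
noncomputable def stdComplexGaussian : Measure ℂ :=
  volume.withDensity fun z => ENNReal.ofReal (Real.pi⁻¹ * Real.exp (-‖z‖ ^ 2))

/-- `E ⊆ [1, ∞)` is a (measurable) set of finite logarithmic measure: `∫_E dt / t < ∞`. -/
def HasFiniteLogMeasure (E : Set ℝ) : Prop :=
  E ⊆ Set.Ici 1 ∧ MeasurableSet E ∧ ∫⁻ t in E, ENNReal.ofReal t⁻¹ < ⊤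

/-- The random Taylor series `f(z) = ∑ aₙ ξₙ zⁿ`. -/
noncomputable def randomTaylor {Ω : Type*} (a : ℕ → ℂ) (ξ : ℕ → Ω → ℂ) (ω : Ω) (z : ℂ) : ℂ :=
  ∑' n, a n * ξ n ω * z ^ n

/-- The hole probability: the probability that `f` has no zeros in the closed disk `|z| ≤ r`. -/
noncomputable def holeProb {Ω : Type*} [MeasurableSpace Ω] (μ : Measure Ω)
    (a : ℕ → ℂ) (ξ : ℕ → Ω → ℂ) (r : ℝ) : ℝ :=
  μ.real {ω | ∀ z : ℂ, ‖z‖ ≤ r → randomTaylor a ξ ω z ≠ 0}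

/-- `S(r) = 2 ∑ log⁺ (|aₙ| rⁿ)`. -/
noncomputable def holeExponent (a : ℕ → ℂ) (r : ℝ) : ℝ :=
  2 * ∑' n, Real.posLog (‖a n‖ * r ^ n)

/-! Write `T = S(r)`, let `A` be the set of `n` with `|aₙ|rⁿ ≥ 1`, and `N = |A|`, so that `∏_{n∈A}
(|aₙ|rⁿ)² = e^T`. Both bounds for the hole probability are `e^{-T}` up to factors whose logarithm is
about `N log T`. The growth lemma makes this error admissible.

Growth: by Borel's lemma applied to `S`, outside a set of finite logarithmic measure `S(r
e^{T^{-η}}) ≤ 2T`. Each index dominant at `ρ` adds at least `nδ` to the sum at `ρe^δ`, so the set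
`B` of indices dominant at a slightly larger radius has `O(T^{(1+η)/2})` elements. The terms outside
`B` decay geometrically at `r`, with sum `O(T^η)` (`exists_finset_of_notMem_borelExceptionalSet`).
The exceptional set is built from `S` and `η` alone, hence is not random.

Holes are likely enough: force `|ξ₀|` to exceed a multiple of `T^η`, make `aₙξₙrⁿ` small for `n ∈
B`, and keep the tail near its mean. The constant term then dominates, and independence gives the
probability (`le_holeProb`).

Holes are unlikely: if `f` has no zero, `log|f|` has circle average `log|f(0)|`. Choose `N` points
`z_j` of the circle with density `|D|²/N!`, where `D` is the generalized Vandermonde determinant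
with exponents in `A`. Each point is uniform, so Jensen's inequality bounds the average of
`∏|f(z_j)|^{-s}` below by `|f(0)|^{-sN}` (`rpow_norm_apply_zero_le`). For fixed points, the map from
`(ξₙ)_{n∈A}` to `(f(z_j))` is affine with real Jacobian `|D|² e^T`. The factor `|D|²` therefore
cancels the density, and the expected average is at most `e^{-T}` times an `N`-th power
(`normSq_circleVandermonde_mul_lintegral_le`). Markov's inequality with `s = 2 - 1/T` makes the base
of that power polynomial in `T`. -/

/-! ### Estimates for the complex Gaussian measure and its products. -/

lemma lintegral_stdComplexGaussian {g : ℂ → ENNReal} (hg : Measurable g) :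
    ∫⁻ z, g z ∂stdComplexGaussian
      = ∫⁻ z, ENNReal.ofReal (Real.pi⁻¹ * Real.exp (-‖z‖ ^ 2)) * g z := by
  rw [stdComplexGaussian, lintegral_withDensity_eq_lintegral_mul _ (by fun_prop) hg]
  rfl

lemma stdComplexGaussian_apply {s : Set ℂ} (hs : MeasurableSet s) :
    stdComplexGaussian s = ∫⁻ z in s, ENNReal.ofReal (Real.pi⁻¹ * Real.exp (-‖z‖ ^ 2)) :=
  withDensity_apply _ hs

lemma stdComplexGaussian_le_smul_volume :
    stdComplexGaussian ≤ ENNReal.ofReal Real.pi⁻¹ • (volume : Measure ℂ) := by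
  rw [stdComplexGaussian, ← withDensity_const]
  refine withDensity_mono (ae_of_all _ fun z => ENNReal.ofReal_le_ofReal ?_)
  have : Real.exp (-‖z‖ ^ 2) ≤ 1 := Real.exp_le_one_iff.2 (by nlinarith [sq_nonneg ‖z‖])
  exact mul_le_of_le_one_right (by positivity) this

lemma le_stdComplexGaussian_of_forall_norm_le {s : Set ℂ} (hs : MeasurableSet s) {t : ℝ}
    (h : ∀ z ∈ s, ‖z‖ ≤ t) :
    ENNReal.ofReal (Real.pi⁻¹ * Real.exp (-t ^ 2)) * volume s ≤ stdComplexGaussian s := by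
  rw [stdComplexGaussian_apply hs, ← setLIntegral_const]
  refine setLIntegral_mono' hs fun z hz => ENNReal.ofReal_le_ofReal ?_
  have : ‖z‖ ^ 2 ≤ t ^ 2 := by
    have := h z hz
    gcongr
  gcongr

lemma le_stdComplexGaussian_closedBall {t : ℝ} (ht0 : 0 ≤ t) (ht : t ≤ 1) :
    ENNReal.ofReal (t ^ 2 / 3) ≤ stdComplexGaussian {z | ‖z‖ ≤ t} := by
  have hset : {z : ℂ | ‖z‖ ≤ t} = Metric.closedBall 0 t := by ext; simp
  have hm : MeasurableSet {z : ℂ | ‖z‖ ≤ t} := by rw [hset]; exact measurableSet_closedBall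
  refine le_trans ?_ (le_stdComplexGaussian_of_forall_norm_le hm (t := 1) fun z hz => le_trans hz ht)
  rw [hset, Complex.volume_closedBall, ← ENNReal.ofReal_pow ht0, ← ENNReal.ofReal_coe_nnreal,
    ← ENNReal.ofReal_mul (by positivity), ← ENNReal.ofReal_mul (by positivity)]
  refine ENNReal.ofReal_le_ofReal ?_
  have h1 : (1 : ℝ) / 3 ≤ Real.exp (-1 ^ 2) := by
    rw [one_pow, Real.exp_neg, one_div]
    exact inv_anti₀ (Real.exp_pos _) (by linarith [Real.exp_one_lt_d9])
  have h2 : Real.pi⁻¹ * Real.exp (-1 ^ 2) * (t ^ 2 * NNReal.pi) = Real.exp (-1 ^ 2) * t ^ 2 := by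
    have : (NNReal.pi : ℝ) = Real.pi := rfl
    rw [this]
    field_simp
  rw [h2]
  nlinarith [sq_nonneg t]

/-- A unit disk centred at `t + 1`, of area `π`, lies in the region, and the density there is at
least `π⁻¹ e^{-(t+2)²}`. -/
lemma le_stdComplexGaussian_norm_gt {t : ℝ} (ht0 : 0 ≤ t) :
    ENNReal.ofReal (Real.exp (-(t + 2) ^ 2)) ≤ stdComplexGaussian {z | t < ‖z‖} := by
  have hsub : Metric.ball ((t + 1 : ℝ) : ℂ) 1 ⊆ {z : ℂ | t < ‖z‖} := fun z hz => by
    have h1 : ‖((t + 1 : ℝ) : ℂ)‖ = t + 1 := by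
      rw [Complex.norm_real, Real.norm_of_nonneg (by linarith)]
    have h2 := norm_sub_norm_le ((t + 1 : ℝ) : ℂ) z
    rw [Metric.mem_ball, dist_comm, dist_eq_norm] at hz
    change t < ‖z‖
    linarith
  refine le_trans ?_ (measure_mono hsub)
  refine le_trans ?_ (le_stdComplexGaussian_of_forall_norm_le measurableSet_ball (t := t + 2) ?_)
  · rw [Complex.volume_ball, ENNReal.ofReal_one, one_pow, one_mul, ← ENNReal.ofReal_coe_nnreal,
      ← ENNReal.ofReal_mul (by positivity)]
    refine ENNReal.ofReal_le_ofReal (le_of_eq ?_)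
    have : (NNReal.pi : ℝ) = Real.pi := rfl
    rw [this]
    field_simp
  · intro z hz
    have h1 : ‖((t + 1 : ℝ) : ℂ)‖ = t + 1 := by
      rw [Complex.norm_real, Real.norm_of_nonneg (by linarith)]
    have h2 := norm_sub_norm_le z ((t + 1 : ℝ) : ℂ)
    rw [Metric.mem_ball, dist_eq_norm] at hz
    linarith

lemma integral_exp_neg_half_mul_norm_sq :
    ∫ z : ℂ, Real.exp (-(1 / 2) * ‖z‖ ^ 2) = 2 * Real.pi := by
  have := Complex.integral_exp_neg_mul_rpow (p := 2) (b := 1 / 2) (by norm_num) (by norm_num)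
  simp only [Real.rpow_two] at this
  rw [this]
  have h1 : ((1 : ℝ) / 2) ^ (-2 / 2 : ℝ) = 2 := by
    rw [show (-2 / 2 : ℝ) = -1 by norm_num, Real.rpow_neg_one]; norm_num
  have h2 : Real.Gamma (2 / 2 + 1) = 1 := by
    rw [show (2 / 2 + 1 : ℝ) = 2 by norm_num, Real.Gamma_two]
  rw [h1, h2]
  ring

/-- Half of the exponent is spent on the bound `e^{-t²/2}`; the other half keeps the integral
finite. -/
lemma stdComplexGaussian_norm_gt_le {t : ℝ} (ht0 : 0 ≤ t) :
    stdComplexGaussian {z | t < ‖z‖} ≤ ENNReal.ofReal (2 * Real.exp (-t ^ 2 / 2)) := by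
  have hm : MeasurableSet {z : ℂ | t < ‖z‖} := measurableSet_lt measurable_const measurable_norm
  have hint : Integrable fun z : ℂ => Real.exp (-(1 / 2) * ‖z‖ ^ 2) := by
    refine Integrable.of_integral_ne_zero ?_
    rw [integral_exp_neg_half_mul_norm_sq]
    positivity
  rw [stdComplexGaussian_apply hm]
  calc ∫⁻ z in {z : ℂ | t < ‖z‖}, ENNReal.ofReal (Real.pi⁻¹ * Real.exp (-‖z‖ ^ 2))
      ≤ ∫⁻ z in {z : ℂ | t < ‖z‖}, ENNReal.ofReal
          (Real.pi⁻¹ * Real.exp (-t ^ 2 / 2) * Real.exp (-(1 / 2) * ‖z‖ ^ 2)) := by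
        refine setLIntegral_mono' hm fun z hz => ENNReal.ofReal_le_ofReal ?_
        have hz' : t < ‖z‖ := hz
        rw [mul_assoc, ← Real.exp_add]
        have : t ^ 2 ≤ ‖z‖ ^ 2 := by gcongr
        gcongr
        linarith
    _ ≤ ∫⁻ z : ℂ, ENNReal.ofReal
          (Real.pi⁻¹ * Real.exp (-t ^ 2 / 2) * Real.exp (-(1 / 2) * ‖z‖ ^ 2)) :=
        setLIntegral_le_lintegral _ _
    _ = ENNReal.ofReal (2 * Real.exp (-t ^ 2 / 2)) := by
        rw [← ofReal_integral_eq_lintegral_ofReal (hint.const_mul _)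
          (ae_of_all _ fun z => by positivity), integral_const_mul,
          integral_exp_neg_half_mul_norm_sq]
        congr 1
        field_simp

lemma lintegral_enorm_stdComplexGaussian_lt_top :
    ∫⁻ z, ‖z‖ₑ ∂stdComplexGaussian < ⊤ := by
  have hint : Integrable fun z : ℂ => ‖z‖ * Real.exp (-‖z‖ ^ 2) := by
    refine Integrable.of_integral_ne_zero ?_
    have := Complex.integral_rpow_mul_exp_neg_rpow (p := 2) (q := 1) (by norm_num) (by norm_num)
    simp only [Real.rpow_two, Real.rpow_one] at this
    rw [this]
    have : 0 < Real.Gamma ((1 + 2) / 2) := Real.Gamma_pos_of_pos (by norm_num)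
    positivity
  rw [lintegral_stdComplexGaussian (by fun_prop)]
  have h := (hint.const_mul Real.pi⁻¹).lintegral_lt_top
  refine lt_of_le_of_lt (lintegral_mono fun z => ?_) h
  rw [← ofReal_norm, ← ENNReal.ofReal_mul (by positivity)]
  exact ENNReal.ofReal_le_ofReal (le_of_eq (by ring))

/-- The inequality is clear on boxes. It passes to all sets because `OuterMeasure.pi` is the largest
outer measure with the prescribed bounds on boxes. -/
lemma MeasureTheory.Measure.pi_const_le_smul {ι α : Type*} [Fintype ι] [MeasurableSpace α]
    {μ ν : Measure α} [SigmaFinite μ] [SigmaFinite ν] {c : ENNReal} (hc : c ≠ ⊤)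
    (h : μ ≤ c • ν) :
    Measure.pi (fun _ : ι => μ) ≤ c ^ Fintype.card ι • Measure.pi (fun _ : ι => ν) := by
  have key : (Measure.pi fun _ : ι => μ).toOuterMeasure
      ≤ OuterMeasure.pi fun _ : ι => (c • ν).toOuterMeasure := by
    rw [OuterMeasure.le_pi]
    intro s _
    change Measure.pi _ _ ≤ ∏ i, (c • ν) (s i)
    rw [Measure.pi_pi]
    exact Finset.prod_le_prod' fun i _ => h (s i)
  lift c to NNReal using hc
  have hpi : Measure.pi (fun _ : ι => (c : ENNReal) • ν)
      = (c : ENNReal) ^ Fintype.card ι • Measure.pi (fun _ : ι => ν) := by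
    have : SigmaFinite ((c : ENNReal) • ν) := inferInstanceAs (SigmaFinite (c • ν))
    refine Measure.pi_eq fun s _ => ?_
    simp [Measure.smul_apply, Measure.pi_pi, Finset.prod_mul_distrib, Finset.prod_const]
  rw [← hpi]
  refine Measure.le_iff.2 fun s hs => ?_
  refine le_trans (key s) ?_
  rw [Measure.pi, toMeasure_apply _ _ hs]

/-! ### Borel's growth lemma and its exceptional set. -/

section Growth

/-- Among sets of given size, an initial segment of the naturals has the least sum. -/
lemma Finset.card_mul_card_sub_one_le_two_mul_sum (s : Finset ℕ) :
    (s.card : ℝ) * (s.card - 1) ≤ 2 * ∑ n ∈ s, (n : ℝ) := by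
  induction s using Finset.induction_on_max with
  | empty => simp
  | insert m s hm ih =>
    have hnot : m ∉ s := fun h => lt_irrefl _ (hm m h)
    have hcard : s.card ≤ m := by
      simpa using Finset.card_le_card (fun x hx => Finset.mem_range.2 (hm x hx) : s ⊆ Finset.range m)
    have hcard' : (s.card : ℝ) ≤ m := by exact_mod_cast hcard
    rw [Finset.sum_insert hnot, Finset.card_insert_of_notMem hnot]
    push_cast
    nlinarith

/-- The exceptional set of Borel's growth lemma for the function `u`. -/
def borelExceptionalSet (u : ℝ → ℝ) (η : ℝ) : Set ℝ :=
  Set.Ici 1 ∩ ⋃ k : ℕ, Set.Icc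
    (sInf {t | 1 ≤ t ∧ 2 ^ (k + 1) ≤ u t} * Real.exp (-((2 : ℝ) ^ (-η)) ^ k))
    (sInf {t | 1 ≤ t ∧ 2 ^ (k + 1) ≤ u t})

lemma setLIntegral_inv_Icc_mul_exp_neg_le {b h : ℝ} (hb : 0 ≤ b) (h0 : 0 ≤ h) (h1 : h ≤ 1) :
    ∫⁻ t in Set.Icc (b * Real.exp (-h)) b, ENNReal.ofReal t⁻¹ ≤ ENNReal.ofReal (2 * h) := by
  -- The case `b = 0` does occur: `sInf ∅ = 0` when `u` never reaches the level. The interval is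
  -- then a single point.
  rcases hb.eq_or_lt with rfl | hb
  · simp
  have hpos : 0 < b * Real.exp (-h) := by positivity
  calc ∫⁻ t in Set.Icc (b * Real.exp (-h)) b, ENNReal.ofReal t⁻¹
      ≤ ∫⁻ _ in Set.Icc (b * Real.exp (-h)) b, ENNReal.ofReal (b * Real.exp (-h))⁻¹ :=
        setLIntegral_mono' measurableSet_Icc fun t ht =>
          ENNReal.ofReal_le_ofReal (inv_anti₀ hpos ht.1)
    _ = ENNReal.ofReal ((b * Real.exp (-h))⁻¹ * (b - b * Real.exp (-h))) := by
        rw [setLIntegral_const, Real.volume_Icc, ← ENNReal.ofReal_mul (by positivity)]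
    _ ≤ ENNReal.ofReal (2 * h) := by
        refine ENNReal.ofReal_le_ofReal ?_
        have h2 : (b * Real.exp (-h))⁻¹ * (b - b * Real.exp (-h)) = Real.exp h - 1 := by
          rw [Real.exp_neg]
          have := Real.exp_pos h
          field_simp
        rw [h2]
        have := Real.abs_exp_sub_one_le (x := h) (by rwa [abs_of_nonneg h0])
        rw [abs_of_nonneg h0] at this
        exact (le_abs_self _).trans this

lemma hasFiniteLogMeasure_borelExceptionalSet (u : ℝ → ℝ) {η : ℝ} (hη : 0 < η) :
    HasFiniteLogMeasure (borelExceptionalSet u η) := by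
  have hq0 : (0 : ℝ) ≤ 2 ^ (-η) := by positivity
  have hq1 : (2 : ℝ) ^ (-η) < 1 := Real.rpow_lt_one_of_one_lt_of_neg (by norm_num) (by linarith)
  refine ⟨Set.inter_subset_left, measurableSet_Ici.inter
    (MeasurableSet.iUnion fun k => measurableSet_Icc), ?_⟩
  calc ∫⁻ t in borelExceptionalSet u η, ENNReal.ofReal t⁻¹
      ≤ ∫⁻ t in ⋃ k : ℕ, Set.Icc
          (sInf {t | 1 ≤ t ∧ 2 ^ (k + 1) ≤ u t} * Real.exp (-((2 : ℝ) ^ (-η)) ^ k))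
          (sInf {t | 1 ≤ t ∧ 2 ^ (k + 1) ≤ u t}), ENNReal.ofReal t⁻¹ :=
        lintegral_mono_set Set.inter_subset_right
    _ ≤ ∑' k : ℕ, ∫⁻ t in Set.Icc
          (sInf {t | 1 ≤ t ∧ 2 ^ (k + 1) ≤ u t} * Real.exp (-((2 : ℝ) ^ (-η)) ^ k))
          (sInf {t | 1 ≤ t ∧ 2 ^ (k + 1) ≤ u t}), ENNReal.ofReal t⁻¹ :=
        lintegral_iUnion_le _ _
    _ ≤ ∑' k : ℕ, ENNReal.ofReal (2 * ((2 : ℝ) ^ (-η)) ^ k) := by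
        refine ENNReal.tsum_le_tsum fun k => setLIntegral_inv_Icc_mul_exp_neg_le
          (Real.sInf_nonneg fun t ht => zero_le_one.trans ht.1) (by positivity)
          (pow_le_one₀ hq0 hq1.le)
    _ < ⊤ := by
        rw [← ENNReal.ofReal_tsum_of_nonneg (fun k => by positivity)
          ((summable_geometric_of_lt_one hq0 hq1).mul_left 2)]
        exact ENNReal.ofReal_lt_top

/-- Borel's growth lemma. -/
lemma le_two_mul_of_notMem_borelExceptionalSet {u : ℝ → ℝ} (hu : MonotoneOn u (Set.Ici 1))
    {η : ℝ} (hη : 0 < η) {r : ℝ} (hr : 1 ≤ r) (hur : 1 ≤ u r)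
    (hrE : r ∉ borelExceptionalSet u η) :
    u (r * Real.exp (u r ^ (-η))) ≤ 2 * u r := by
  -- The dyadic level of `u r` selects the interval: a jump past `2 * u r` crosses level `2^(k+1)`
  -- within logarithmic distance `2^(-ηk)` to the right of `r`.
  obtain ⟨k, hk, hk'⟩ := exists_nat_pow_near hur (by norm_num : (1 : ℝ) < 2)
  have hle : u r ^ (-η) ≤ ((2 : ℝ) ^ (-η)) ^ k := by
    rw [← Real.rpow_natCast, ← Real.rpow_mul (by norm_num), mul_comm, Real.rpow_mul (by norm_num),
      Real.rpow_natCast]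
    exact Real.rpow_le_rpow_of_nonpos (by positivity) hk (by linarith)
  by_contra! hcon
  apply hrE
  set X := {t | 1 ≤ t ∧ 2 ^ (k + 1) ≤ u t} with hX
  have hpos : 0 < u r ^ (-η) := by positivity
  have hge1 : 1 ≤ Real.exp (u r ^ (-η)) := Real.one_le_exp hpos.le
  have hmem : r * Real.exp (u r ^ (-η)) ∈ X := by
    refine ⟨by nlinarith, ?_⟩
    rw [pow_succ]
    linarith
  have hbdd : BddBelow X := ⟨1, fun t ht => ht.1⟩
  refine ⟨hr, Set.mem_iUnion.2 ⟨k, ?_, ?_⟩⟩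
  · have h1 : sInf X ≤ r * Real.exp (u r ^ (-η)) := csInf_le hbdd hmem
    have h2 : r * Real.exp (u r ^ (-η)) ≤ r * Real.exp (((2 : ℝ) ^ (-η)) ^ k) := by gcongr
    rw [Real.exp_neg]
    exact mul_inv_le_of_le_mul₀ (by positivity) (by positivity) (h1.trans h2)
  · refine le_csInf ⟨_, hmem⟩ fun t ht => ?_
    by_contra! hlt
    have := hu ht.1 hr hlt.le
    linarith [ht.2]

end Growth

/-! ### Dominant terms and the growth of the exponent. -/

section Coefficients

variable {a : ℕ → ℂ}

open Classical in
/-- The indices of the terms `aₙ zⁿ` of modulus at least one on the circle `|z| = r`. -/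
noncomputable def dominantIndices (a : ℕ → ℂ) (r : ℝ) : Finset ℕ :=
  if h : {n | 1 ≤ ‖a n‖ * r ^ n}.Finite then h.toFinset else ∅

lemma summable_norm_mul_pow (ha : ∀ z : ℂ, Summable fun n => a n * z ^ n) {r : ℝ} (hr : 0 ≤ r) :
    Summable fun n => ‖a n‖ * r ^ n := by
  simpa [abs_of_nonneg hr] using (ha r).norm

lemma mem_dominantIndices (ha : ∀ z : ℂ, Summable fun n => a n * z ^ n) {r : ℝ} (hr : 0 ≤ r)
    {n : ℕ} : n ∈ dominantIndices a r ↔ 1 ≤ ‖a n‖ * r ^ n := by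
  have h : {n | 1 ≤ ‖a n‖ * r ^ n}.Finite := by
    have h1 := (summable_norm_mul_pow ha hr).tendsto_cofinite_zero.eventually_lt_const one_pos
    simpa [Filter.eventually_cofinite] using h1
  simp [dominantIndices, h]

lemma posLog_eq_zero_of_notMem_dominantIndices
    (ha : ∀ z : ℂ, Summable fun n => a n * z ^ n) {r : ℝ} (hr : 0 ≤ r) {n : ℕ}
    (hn : n ∉ dominantIndices a r) : Real.posLog (‖a n‖ * r ^ n) = 0 := by
  rw [mem_dominantIndices ha hr, not_le] at hn
  rw [Real.posLog_eq_zero_iff, abs_of_nonneg (by positivity)]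
  exact hn.le

lemma holeExponent_eq_sum (ha : ∀ z : ℂ, Summable fun n => a n * z ^ n) {r : ℝ} (hr : 0 ≤ r)
    {s : Finset ℕ} (hs : dominantIndices a r ⊆ s) :
    holeExponent a r = 2 * ∑ n ∈ s, Real.posLog (‖a n‖ * r ^ n) := by
  rw [holeExponent, tsum_eq_sum fun n hn =>
    posLog_eq_zero_of_notMem_dominantIndices ha hr fun h => hn (hs h)]

lemma two_mul_sum_posLog_le_holeExponent (ha : ∀ z : ℂ, Summable fun n => a n * z ^ n) {r : ℝ}
    (hr : 0 ≤ r) (s : Finset ℕ) :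
    2 * ∑ n ∈ s, Real.posLog (‖a n‖ * r ^ n) ≤ holeExponent a r := by
  classical
  rw [holeExponent_eq_sum ha hr (s := dominantIndices a r ∪ s) Finset.subset_union_left]
  exact mul_le_mul_of_nonneg_left (Finset.sum_le_sum_of_subset_of_nonneg
    Finset.subset_union_right fun _ _ _ => Real.posLog_nonneg) zero_le_two

lemma monotoneOn_holeExponent (ha : ∀ z : ℂ, Summable fun n => a n * z ^ n) :
    MonotoneOn (holeExponent a) (Set.Ici 0) := by
  intro r hr r' hr' hrr'
  rw [holeExponent_eq_sum ha hr subset_rfl]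
  refine le_trans ?_ (two_mul_sum_posLog_le_holeExponent ha hr' (dominantIndices a r))
  have hr0 : 0 ≤ r := hr
  gcongr with n hn

lemma tendsto_holeExponent (ha : ∀ z : ℂ, Summable fun n => a n * z ^ n)
    (hnonconst : ¬ ∃ c : ℂ, ∀ z : ℂ, ∑' n, a n * z ^ n = c) :
    Tendsto (holeExponent a) atTop atTop := by
  obtain ⟨k, hk0, hk⟩ : ∃ k, k ≠ 0 ∧ a k ≠ 0 := by
    by_contra! h
    refine hnonconst ⟨a 0, fun z => ?_⟩
    rw [tsum_eq_single 0 fun n hn => by rw [h n hn, zero_mul]]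
    simp
  have h1 : Tendsto (fun r : ℝ => Real.log (‖a k‖ * r ^ k)) atTop atTop :=
    Real.tendsto_log_atTop.comp
      ((tendsto_pow_atTop hk0).const_mul_atTop (norm_pos_iff.2 hk))
  refine tendsto_atTop_mono' _ ?_ h1
  filter_upwards [eventually_ge_atTop 0] with r hr
  have h2 := two_mul_sum_posLog_le_holeExponent ha hr {k}
  rw [Finset.sum_singleton] at h2
  have h3 : Real.log (‖a k‖ * r ^ k) ≤ Real.posLog (‖a k‖ * r ^ k) := le_max_right _ _
  have h4 : 0 ≤ Real.posLog (‖a k‖ * r ^ k) := Real.posLog_nonneg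
  linarith

/-- Going from `r` to `r e^δ` raises the logarithm of the `n`-th term by `nδ`. A dominant term
starts from a nonnegative logarithm, so it contributes at least `nδ`. -/
lemma card_dominantIndices_mul_le (ha : ∀ z : ℂ, Summable fun n => a n * z ^ n) {r δ : ℝ}
    (hr : 0 < r) (hδ : 0 ≤ δ) :
    ((dominantIndices a r).card : ℝ) * ((dominantIndices a r).card - 1) * δ
      ≤ holeExponent a (r * Real.exp δ) := by
  refine le_trans ?_ (two_mul_sum_posLog_le_holeExponent ha (by positivity) (dominantIndices a r))
  refine (mul_le_mul_of_nonneg_right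
    (Finset.card_mul_card_sub_one_le_two_mul_sum _) hδ).trans ?_
  rw [mul_assoc, Finset.sum_mul]
  gcongr with n hn
  rw [mem_dominantIndices ha hr.le] at hn
  refine le_trans ?_ (le_max_right _ _)
  have h1 : 0 < ‖a n‖ * r ^ n := by linarith
  rw [mul_pow, ← mul_assoc, ← Real.exp_nat_mul, Real.log_mul h1.ne' (Real.exp_pos _).ne',
    Real.log_exp]
  linarith [Real.log_nonneg hn]

lemma tsum_ofReal_exp_neg_le {δ : ℝ} (h0 : 0 < δ) (h1 : δ ≤ 1) :
    ∑' n : ℕ, ENNReal.ofReal (Real.exp (-(n * δ))) ≤ ENNReal.ofReal (2 / δ) := by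
  have hlt : Real.exp (-δ) < 1 := Real.exp_lt_one_iff.2 (by linarith)
  have hsum := summable_geometric_of_lt_one (Real.exp_pos (-δ)).le hlt
  have heq : ∀ n : ℕ, Real.exp (-(n * δ)) = Real.exp (-δ) ^ n := fun n => by
    rw [← Real.exp_nat_mul, mul_neg]
  simp_rw [heq]
  rw [← ENNReal.ofReal_tsum_of_nonneg (fun n => by positivity) hsum,
    tsum_geometric_of_lt_one (Real.exp_pos (-δ)).le hlt]
  refine ENNReal.ofReal_le_ofReal ?_
  have h2 : Real.exp (-δ) ≤ 1 - δ / 2 := by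
    have h3 : 1 + δ ≤ Real.exp δ := by linarith [Real.add_one_le_exp δ]
    have h4 : Real.exp (-δ) ≤ (1 + δ)⁻¹ := by
      rw [Real.exp_neg]; exact inv_anti₀ (by linarith) h3
    refine h4.trans ?_
    rw [inv_le_iff_one_le_mul₀ (by linarith)]
    nlinarith
  rw [← one_div, div_le_div_iff₀ (by linarith) h0]
  linarith

/-- Outside the exceptional set, few terms of the series are large and the remaining ones
have a small sum. -/
lemma exists_finset_of_notMem_borelExceptionalSet
    (ha : ∀ z : ℂ, Summable fun n => a n * z ^ n) {η r : ℝ} (hη : 0 < η) (hr : 1 ≤ r)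
    (hT : 1 ≤ holeExponent a r) (hrE : r ∉ borelExceptionalSet (holeExponent a) η) :
    ∃ B : Finset ℕ, dominantIndices a r ⊆ B ∧
      (B.card : ℝ) ≤ 3 * holeExponent a r ^ ((1 + η) / 2) ∧
      ∑' n : ℕ, (if n ∈ B then 0 else ENNReal.ofReal (‖a n‖ * r ^ n))
        ≤ ENNReal.ofReal (4 * holeExponent a r ^ η) := by
  set T := holeExponent a r with hTdef
  have hT0 : 0 < T := by linarith
  -- Half the Borel step: one half enlarges the disk that defines `B`, the other half is used to
  -- count `B`.
  set δ := T ^ (-η) / 2 with hδ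
  have hδ0 : 0 < δ := by positivity
  have hδ1 : δ ≤ 1 := by
    have : T ^ (-η) ≤ 1 := Real.rpow_le_one_of_one_le_of_nonpos hT (by linarith)
    linarith
  have hr0 : 0 < r := by linarith
  have hmul : T ^ (-η) * T ^ η = 1 := by
    rw [← Real.rpow_add hT0]; simp
  refine ⟨dominantIndices a (r * Real.exp δ), ?_, ?_, ?_⟩
  · intro n hn
    rw [mem_dominantIndices ha hr0.le] at hn
    rw [mem_dominantIndices ha (by positivity)]
    refine hn.trans ?_
    have : 1 ≤ Real.exp δ := Real.one_le_exp hδ0.le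
    gcongr
    nlinarith
  · have h1 := card_dominantIndices_mul_le ha (r := r * Real.exp δ) (by positivity) hδ0.le
    rw [mul_assoc r, ← Real.exp_add, hδ, add_halves] at h1
    have hmono : MonotoneOn (holeExponent a) (Set.Ici 1) :=
      (monotoneOn_holeExponent ha).mono (Set.Ici_subset_Ici.2 zero_le_one)
    have h2 := h1.trans (le_two_mul_of_notMem_borelExceptionalSet hmono hη hr hT hrE)
    rw [← hδ, ← hTdef] at h2
    set N : ℝ := ((dominantIndices a (r * Real.exp δ)).card : ℝ) with hN
    set w := T ^ ((1 + η) / 2) with hw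
    have hw2 : w * w = T * T ^ η := by
      rw [hw, ← Real.rpow_add hT0, add_halves, Real.rpow_add hT0, Real.rpow_one]
    have hw1 : 1 ≤ w := Real.one_le_rpow hT (by positivity)
    have h3 : N * (N - 1) ≤ 4 * (w * w) := by
      have h4 : N * (N - 1) * (T ^ (-η) / 2) * (2 * T ^ η) ≤ 2 * T * (2 * T ^ η) := by gcongr
      have h5 : N * (N - 1) * (T ^ (-η) / 2) * (2 * T ^ η) = N * (N - 1) := by
        linear_combination (N * (N - 1)) * hmul
      rw [h5] at h4
      rw [hw2]
      linarith
    by_contra! hcon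
    nlinarith
  · have hb : ENNReal.ofReal (2 / δ) = ENNReal.ofReal (4 * T ^ η) := by
      congr 1
      rw [div_eq_iff hδ0.ne', hδ]
      linear_combination -2 * hmul
    rw [← hb]
    refine le_trans (ENNReal.tsum_le_tsum fun n => ?_) (tsum_ofReal_exp_neg_le hδ0 hδ1)
    split_ifs with hn
    · exact zero_le
    -- A term that is not dominant at `r e^δ` is less than `e^{-nδ}` at `r`.
    · refine ENNReal.ofReal_le_ofReal ?_
      rw [mem_dominantIndices ha (by positivity), not_le, mul_pow, ← mul_assoc,
        ← Real.exp_nat_mul] at hn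
      rw [Real.exp_neg, ← one_div, le_div_iff₀ (Real.exp_pos _)]
      exact hn.le

end Coefficients

/-! ### Independence of two blocks of variables, possibly infinite. -/

section Independence

lemma ProbabilityTheory.iIndepFun.indepFun_of_disjoint {Ω ι β : Type*} [MeasurableSpace Ω]
    [MeasurableSpace β] {μ : Measure Ω} {f : ι → Ω → β} (hf : iIndepFun f μ)
    (hm : ∀ i, Measurable (f i)) {S T : Set ι} (hST : Disjoint S T) :
    IndepFun (fun ω (i : S) => f i ω) (fun ω (i : T) => f i ω) μ := by
  have key : ∀ U : Set ι, MeasurableSpace.comap (fun ω (i : U) => f i ω) MeasurableSpace.pi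
      = ⨆ i ∈ U, MeasurableSpace.comap (f i) inferInstance := fun U => by
    rw [MeasurableSpace.pi, MeasurableSpace.comap_iSup, iSup_subtype']
    refine iSup_congr fun i => ?_
    rw [MeasurableSpace.comap_comp]
    rfl
  have h := indep_iSup_of_disjoint (fun i => (hm i).comap_le) hf hST
  rw [← key S, ← key T] at h
  exact h

end Independence

/-! ### Almost sure convergence and the lower bound for the hole probability. -/

section GaussianSequence

variable {Ω : Type*} [MeasurableSpace Ω] {μ : Measure Ω} {ξ : ℕ → Ω → ℂ} {a : ℕ → ℂ}

lemma lintegral_tsum_mul_enorm (hm : ∀ n, Measurable (ξ n))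
    (hlaw : ∀ n, μ.map (ξ n) = stdComplexGaussian) (c : ℕ → ENNReal) :
    ∫⁻ ω, ∑' n, c n * ‖ξ n ω‖ₑ ∂μ
      = (∑' n, c n) * ∫⁻ z, ‖z‖ₑ ∂stdComplexGaussian := by
  rw [lintegral_tsum fun n => ((hm n).enorm.const_mul _).aemeasurable, ← ENNReal.tsum_mul_right]
  refine tsum_congr fun n => ?_
  rw [lintegral_const_mul _ (hm n).enorm, ← hlaw n, lintegral_map measurable_enorm (hm n)]

lemma ae_summable_norm_mul_pow (ha : ∀ z : ℂ, Summable fun n => a n * z ^ n)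
    (hm : ∀ n, Measurable (ξ n)) (hlaw : ∀ n, μ.map (ξ n) = stdComplexGaussian) :
    ∀ᵐ ω ∂μ, ∀ r : ℝ, 0 ≤ r → Summable fun n => ‖a n‖ * ‖ξ n ω‖ * r ^ n := by
  -- Integer radii suffice, so that a single null set serves all `r`.
  have h1 : ∀ k : ℕ, ∀ᵐ ω ∂μ, ∑' n, ENNReal.ofReal (‖a n‖ * (k : ℝ) ^ n) * ‖ξ n ω‖ₑ < ⊤ := by
    intro k
    refine ae_lt_top (Measurable.tsum fun n => (hm n).enorm.const_mul _) ?_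
    rw [lintegral_tsum_mul_enorm hm hlaw]
    refine ENNReal.mul_ne_top ?_ lintegral_enorm_stdComplexGaussian_lt_top.ne
    rw [← ENNReal.ofReal_tsum_of_nonneg (fun n => by positivity)
      (summable_norm_mul_pow ha k.cast_nonneg)]
    exact ENNReal.ofReal_ne_top
  filter_upwards [ae_all_iff.2 h1] with ω hω r hr
  obtain ⟨k, hk⟩ := exists_nat_ge r
  have h2 : Summable fun n => ‖a n‖ * ‖ξ n ω‖ * (k : ℝ) ^ n := by
    have h3 := ENNReal.summable_toReal (hω k).ne
    refine h3.congr fun n => ?_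
    rw [ENNReal.toReal_mul, ENNReal.toReal_ofReal (by positivity), toReal_enorm]
    ring
  refine h2.of_nonneg_of_le (fun n => by positivity) fun n => ?_
  gcongr

lemma ae_summable_randomTaylor (ha : ∀ z : ℂ, Summable fun n => a n * z ^ n)
    (hm : ∀ n, Measurable (ξ n)) (hlaw : ∀ n, μ.map (ξ n) = stdComplexGaussian) :
    ∀ᵐ ω ∂μ, ∀ z : ℂ, Summable fun n => a n * ξ n ω * z ^ n := by
  filter_upwards [ae_summable_norm_mul_pow ha hm hlaw] with ω hω z
  refine Summable.of_norm ?_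
  simpa using hω ‖z‖ (norm_nonneg z)

lemma tsum_ne_zero_of_enorm_lt {F : ℕ → ℂ} (hF : Summable F)
    (h : ∑' n, (if n = 0 then 0 else ‖F n‖ₑ) < ‖F 0‖ₑ) : ∑' n, F n ≠ 0 := by
  classical
  intro h0
  rw [hF.tsum_eq_add_tsum_ite 0, add_eq_zero_iff_eq_neg] at h0
  rw [h0, enorm_neg] at h
  refine absurd (enorm_tsum_le_tsum_enorm (f := fun n => if n = 0 then 0 else F n)) (not_le.2 ?_)
  refine lt_of_le_of_lt (le_of_eq (tsum_congr fun n => ?_)) h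
  split_ifs <;> simp

/-- Small coefficients and a large constant term force the absence of zeros. -/
lemma le_holeProb [IsProbabilityMeasure μ] (ha : ∀ z : ℂ, Summable fun n => a n * z ^ n)
    (hm : ∀ n, Measurable (ξ n)) (hind : iIndepFun ξ μ)
    (hlaw : ∀ n, μ.map (ξ n) = stdComplexGaussian) {r : ℝ} (hr : 0 ≤ r) (B : Finset ℕ)
    {K q t : ℝ} (hK : 0 < K) (hq : 1 ≤ q) (ht : 0 ≤ t)
    (htail : (∑' n, (if n ∈ B then 0 else ENNReal.ofReal (‖a n‖ * r ^ n)))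
      * ∫⁻ z, ‖z‖ₑ ∂stdComplexGaussian ≤ ENNReal.ofReal (K / 2))
    (hlarge : B.card / q + K ≤ ‖a 0‖ * t) :
    Real.exp (-(t + 2) ^ 2)
      * (∏ n ∈ B.erase 0, (1 / (q * max 1 (‖a n‖ * r ^ n))) ^ 2 / 3) * (1 / 2)
      ≤ holeProb μ a ξ r := by
  classical
  set τ : ℕ → ℝ := fun n => 1 / (q * max 1 (‖a n‖ * r ^ n)) with hτ
  have hτ0 : ∀ n, 0 ≤ τ n := fun n => by positivity
  have hτ1 : ∀ n, τ n ≤ 1 := fun n => by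
    rw [hτ]
    refine div_le_one_of_le₀ ?_ (by positivity)
    exact one_le_mul_of_one_le_of_one_le hq (le_max_left _ _)
  -- The index `0` need not lie in `B`; it is added because `ξ 0` carries its own constraint.
  set s : Finset ℕ := insert 0 B with hs
  set A : ℕ → Set ℂ := fun n => if n = 0 then {z | t < ‖z‖} else {z | ‖z‖ ≤ τ n} with hA
  have hAm : ∀ n, MeasurableSet (A n) := fun n => by
    rw [hA]
    dsimp only
    split_ifs
    · exact measurableSet_lt measurable_const measurable_norm
    · exact measurableSet_le measurable_norm measurable_const
  set c : ℕ → ENNReal := fun n => if n ∈ s then 0 else ENNReal.ofReal (‖a n‖ * r ^ n) with hc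
  set V : Set Ω := {ω | ∑' n, c n * ‖ξ n ω‖ₑ ≤ ENNReal.ofReal K} with hV
  set U : Set Ω := ⋂ n ∈ s, ξ n ⁻¹' A n with hU
  have hVm : MeasurableSet V :=
    measurableSet_le (Measurable.tsum fun n => (hm n).enorm.const_mul _) measurable_const
  -- the probabilities of the two events
  have hVprob : ENNReal.ofReal (1 / 2) ≤ μ V := by
    -- Markov's inequality: the mean of the tail is at most `K / 2`.
    have hcompl : μ Vᶜ ≤ ENNReal.ofReal (1 / 2) := by
      have h1 : μ Vᶜ ≤ μ {ω | ENNReal.ofReal K ≤ ∑' n, c n * ‖ξ n ω‖ₑ} :=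
        by
        refine measure_mono fun ω hω => ?_
        rw [hV, Set.mem_compl_iff, Set.mem_ofPred_eq, not_le] at hω
        exact hω.le
      refine h1.trans ((meas_ge_le_lintegral_div
        (Measurable.tsum fun n => (hm n).enorm.const_mul _).aemeasurable
        (by simpa using hK) ENNReal.ofReal_ne_top).trans ?_)
      rw [lintegral_tsum_mul_enorm hm hlaw]
      refine ENNReal.div_le_of_le_mul ?_
      rw [← ENNReal.ofReal_mul (by norm_num), show 1 / 2 * K = K / 2 by ring]
      refine le_trans ?_ htail
      gcongr with n
      rw [hc]
      by_cases hnB : n ∈ B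
      · simp [hs, hnB]
      · simp only [hnB, if_false]
        split_ifs <;> simp
    have h2 := prob_add_prob_compl hVm (μ := μ)
    by_contra! hlt
    have h3 : μ V + μ Vᶜ < ENNReal.ofReal (1 / 2) + ENNReal.ofReal (1 / 2) :=
      ENNReal.add_lt_add_of_lt_of_le (measure_ne_top _ _) hlt hcompl
    rw [h2, ← ENNReal.ofReal_add (by norm_num) (by norm_num)] at h3
    norm_num at h3
  have hUprob : ENNReal.ofReal (Real.exp (-(t + 2) ^ 2) * ∏ n ∈ B.erase 0, τ n ^ 2 / 3) ≤ μ U := by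
    have h1 : μ U = ∏ n ∈ s, μ (ξ n ⁻¹' A n) :=
      hind.measure_inter_preimage_eq_mul s fun n _ => hAm n
    have h2 : ∀ n, μ (ξ n ⁻¹' A n) = stdComplexGaussian (A n) := fun n => by
      rw [← hlaw n, Measure.map_apply (hm n) (hAm n)]
    rw [h1, ← Finset.mul_prod_erase s _ (Finset.mem_insert_self 0 B),
      ENNReal.ofReal_mul (by positivity), ENNReal.ofReal_prod_of_nonneg (fun n _ => by positivity),
      hs, Finset.erase_insert_eq_erase]
    refine mul_le_mul' ?_ (Finset.prod_le_prod' fun n hn => ?_)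
    · rw [h2]
      simpa [hA] using le_stdComplexGaussian_norm_gt ht
    · rw [h2]
      simpa [hA, Finset.ne_of_mem_erase hn] using
        le_stdComplexGaussian_closedBall (hτ0 n) (hτ1 n)
  -- the two events are independent
  have hUV : μ (U ∩ V) = μ U * μ V := by
    have hI := hind.indepFun_of_disjoint hm
      (S := (s : Set ℕ)) (T := (s : Set ℕ)ᶜ) disjoint_compl_right
    have hU' : U = (fun ω (i : (s : Set ℕ)) => ξ i ω) ⁻¹' {x | ∀ i : (s : Set ℕ), x i ∈ A i} := by
      ext ω
      simp [hU]
    have hV' : V = (fun ω (i : ((s : Set ℕ)ᶜ : Set ℕ)) => ξ i ω) ⁻¹'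
        {y | ∑' i : ((s : Set ℕ)ᶜ : Set ℕ), c i * ‖y i‖ₑ ≤ ENNReal.ofReal K} := by
      ext ω
      simp only [hV, Set.mem_ofPred_eq, Set.mem_preimage]
      rw [tsum_subtype ((s : Set ℕ)ᶜ) fun n => c n * ‖ξ n ω‖ₑ]
      refine iff_of_eq (congrArg (· ≤ ENNReal.ofReal K) (tsum_congr fun n => ?_))
      by_cases hn : n ∈ s
      · simp [hc, hn]
      · simp [hn]
    rw [hU', hV']
    refine hI.measure_inter_preimage_eq_mul _ _ ?_ ?_
    · have : {x : ↥(s : Set ℕ) → ℂ | ∀ i : (s : Set ℕ), x i ∈ A i}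
          = Set.univ.pi fun i : (s : Set ℕ) => A i := by
        ext; simp
      rw [this]
      exact MeasurableSet.univ_pi fun i => hAm i
    · exact measurableSet_le
        (Measurable.tsum fun i => (measurable_pi_apply i).enorm.const_mul _)
        measurable_const
  -- on both events there are no zeros
  have hsub : μ (U ∩ V) ≤ μ {ω | ∀ z : ℂ, ‖z‖ ≤ r → randomTaylor a ξ ω z ≠ 0} := by
    -- Only monotonicity of the outer measure is used, so measurability of the hole event is never
    -- needed.
    refine measure_mono_ae ?_
    filter_upwards [ae_summable_randomTaylor ha hm hlaw] with ω hω hUVω z hz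
    obtain ⟨hωU, hωV⟩ : ω ∈ U ∩ V := hUVω
    refine tsum_ne_zero_of_enorm_lt (hω z) ?_
    have h0 : t < ‖ξ 0 ω‖ := by
      have := Set.mem_iInter₂.1 hωU 0 (Finset.mem_insert_self 0 B)
      simpa [hA] using this
    have hle : ∀ n, ‖a n * ξ n ω * z ^ n‖ₑ ≤ ENNReal.ofReal (‖a n‖ * r ^ n) * ‖ξ n ω‖ₑ := by
      intro n
      rw [← ofReal_norm, ← ofReal_norm, ← ENNReal.ofReal_mul (by positivity)]
      refine ENNReal.ofReal_le_ofReal ?_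
      rw [norm_mul, norm_mul, norm_pow, mul_right_comm]
      gcongr
    have hsmall : ∀ n ∈ B.erase 0, ‖a n * ξ n ω * z ^ n‖ₑ ≤ ENNReal.ofReal (1 / q) := by
      intro n hn
      have hn' : ‖ξ n ω‖ ≤ τ n := by
        have := Set.mem_iInter₂.1 hωU n (Finset.mem_insert_of_mem (Finset.mem_of_mem_erase hn))
        simpa [hA, Finset.ne_of_mem_erase hn] using this
      refine (hle n).trans ?_
      rw [← ofReal_norm (ξ n ω), ← ENNReal.ofReal_mul (by positivity)]
      refine ENNReal.ofReal_le_ofReal ?_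
      calc ‖a n‖ * r ^ n * ‖ξ n ω‖ ≤ max 1 (‖a n‖ * r ^ n) * τ n := by
            gcongr
            exact le_max_right _ _
        _ = 1 / q := by
            rw [hτ]
            have : 0 < max 1 (‖a n‖ * r ^ n) := by positivity
            field_simp
    calc ∑' n, (if n = 0 then 0 else ‖a n * ξ n ω * z ^ n‖ₑ)
        ≤ ∑' n, ((if n ∈ B.erase 0 then ENNReal.ofReal (1 / q) else 0) + c n * ‖ξ n ω‖ₑ) := by
          refine ENNReal.tsum_le_tsum fun n => ?_
          by_cases hn0 : n = 0
          · simp [hn0]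
          by_cases hnB : n ∈ B
          · have hn : n ∈ B.erase 0 := Finset.mem_erase.2 ⟨hn0, hnB⟩
            simp only [hn0, if_false, hn, if_true]
            exact (hsmall n hn).trans le_self_add
          · simp only [hc, hs, hn0, hnB, Finset.mem_erase, Finset.mem_insert, if_false, or_self,
              and_false, zero_add]
            exact hle n
      _ = ∑ n ∈ B.erase 0, ENNReal.ofReal (1 / q) + ∑' n, c n * ‖ξ n ω‖ₑ := by
          rw [ENNReal.tsum_add, tsum_eq_sum (s := B.erase 0) fun n hn => if_neg hn]
          congr 1
          exact Finset.sum_congr rfl fun n hn => if_pos hn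
      _ ≤ ENNReal.ofReal (B.card / q) + ENNReal.ofReal K := by
          refine add_le_add ?_ hωV
          rw [Finset.sum_const, ← ENNReal.ofReal_nsmul, nsmul_eq_mul]
          refine ENNReal.ofReal_le_ofReal ?_
          rw [mul_one_div]
          gcongr
          exact Finset.erase_subset _ _
      _ = ENNReal.ofReal (B.card / q + K) := by
          rw [ENNReal.ofReal_add (by positivity) hK.le]
      _ < ‖a 0 * ξ 0 ω * z ^ 0‖ₑ := by
          have ha0 : 0 < ‖a 0‖ := by
            rcases (norm_nonneg (a 0)).eq_or_lt with h | h
            · rw [← h, zero_mul] at hlarge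
              have : (0 : ℝ) ≤ B.card / q := by positivity
              linarith
            · exact h
          have h1 : ‖a 0‖ * t < ‖a 0‖ * ‖ξ 0 ω‖ := by gcongr
          rw [pow_zero, mul_one, ← ofReal_norm, norm_mul, ENNReal.ofReal_lt_ofReal_iff]
          · linarith
          · exact mul_pos ha0 (ht.trans_lt h0)
  have hfinal : ENNReal.ofReal (Real.exp (-(t + 2) ^ 2) * (∏ n ∈ B.erase 0, τ n ^ 2 / 3) * (1 / 2))
      ≤ μ {ω | ∀ z : ℂ, ‖z‖ ≤ r → randomTaylor a ξ ω z ≠ 0} := by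
    refine le_trans ?_ hsub
    rw [hUV, ENNReal.ofReal_mul' (by norm_num)]
    exact mul_le_mul' hUprob hVprob
  rw [holeProb, Measure.real]
  exact (ENNReal.ofReal_le_iff_le_toReal (measure_ne_top _ _)).1 hfinal

/-- The logarithmic form of `le_holeProb`. -/
lemma neg_log_holeProb_le [IsProbabilityMeasure μ] (ha : ∀ z : ℂ, Summable fun n => a n * z ^ n)
    (hm : ∀ n, Measurable (ξ n)) (hind : iIndepFun ξ μ)
    (hlaw : ∀ n, μ.map (ξ n) = stdComplexGaussian) {r : ℝ} (hr : 0 ≤ r) (B : Finset ℕ)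
    {K q t : ℝ} (hK : 0 < K) (hq : 1 ≤ q) (ht : 0 ≤ t)
    (htail : (∑' n, (if n ∈ B then 0 else ENNReal.ofReal (‖a n‖ * r ^ n)))
      * ∫⁻ z, ‖z‖ₑ ∂stdComplexGaussian ≤ ENNReal.ofReal (K / 2))
    (hlarge : B.card / q + K ≤ ‖a 0‖ * t) :
    0 < holeProb μ a ξ r ∧
    -Real.log (holeProb μ a ξ r)
      ≤ holeExponent a r + (t + 2) ^ 2 + B.card * (2 * Real.log q + 2) + 1 := by
  have h := le_holeProb ha hm hind hlaw hr B hK hq ht htail hlarge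
  have hq0 : 0 < q := by linarith
  have hmax : ∀ n, 0 < max 1 (‖a n‖ * r ^ n) := fun n => by positivity
  have hprod : 0 < ∏ n ∈ B.erase 0, (1 / (q * max 1 (‖a n‖ * r ^ n))) ^ 2 / 3 :=
    Finset.prod_pos fun n _ => by have := hmax n; positivity
  have hpos : 0 < holeProb μ a ξ r := lt_of_lt_of_le (by positivity) h
  refine ⟨hpos, ?_⟩
  have h1 := Real.log_le_log (by positivity) h
  rw [Real.log_mul (by positivity) (by norm_num), Real.log_mul (by positivity) hprod.ne',
    Real.log_exp, Real.log_prod fun n _ => by have := hmax n; positivity] at h1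
  have h2 : ∀ n ∈ B.erase 0, -(2 * Real.posLog (‖a n‖ * r ^ n) + (2 * Real.log q + 2))
      ≤ Real.log ((1 / (q * max 1 (‖a n‖ * r ^ n))) ^ 2 / 3) := fun n _ => by
    have hmn := hmax n
    rw [Real.log_div (by positivity) (by norm_num), Real.log_pow, one_div, Real.log_inv,
      Real.log_mul hq0.ne' hmn.ne', ← Real.posLog_eq_log_max_one (by positivity)]
    have h3 : Real.log 3 ≤ 2 := by linarith [Real.log_le_sub_one_of_pos (x := 3) (by norm_num)]
    push_cast
    linarith
  have h4 := Finset.sum_le_sum h2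
  rw [Finset.sum_neg_distrib, Finset.sum_add_distrib, ← Finset.mul_sum, Finset.sum_const,
    nsmul_eq_mul] at h4
  have h5 := two_mul_sum_posLog_le_holeExponent ha hr (B.erase 0)
  have h6 : ((B.erase 0).card : ℝ) * (2 * Real.log q + 2) ≤ B.card * (2 * Real.log q + 2) := by
    have := Real.log_nonneg hq
    gcongr
    exact Finset.erase_subset _ _
  have h7 : -1 ≤ Real.log (1 / 2) := by
    rw [one_div, Real.log_inv]
    linarith [Real.log_two_lt_d9]
  linarith

end GaussianSequence

/-! ### The determinantal density on the circle and Jensen's inequality. -/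

section Determinantal

lemma integral_fourier_haarAddCircle (n : ℤ) :
    ∫ t, fourier n t ∂(AddCircle.haarAddCircle : Measure UnitAddCircle) = if n = 0 then 1 else 0 := by
  split_ifs with hn
  · subst hn
    simp
  · exact integral_eq_zero_of_add_right_eq_neg (fourier_add_half_inv_index hn (by norm_num))

lemma integral_unitAddCircle_eq_circleAverage (h : ℂ → ℝ) (r : ℝ) :
    ∫ t, h (r * fourier 1 t) ∂(AddCircle.haarAddCircle : Measure UnitAddCircle)
      = Real.circleAverage h 0 r := by
  have hpi := Real.pi_pos
  rw [AddCircle.integral_haarAddCircle,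
    ← AddCircle.intervalIntegral_preimage 1 0, Real.circleAverage_def]
  have h1 : ∀ x : ℝ, h (r * fourier 1 (x : UnitAddCircle)) = h (circleMap 0 r (2 * Real.pi * x)) := by
    intro x
    rw [fourier_coe_apply, circleMap, zero_add]
    congr 3
    push_cast
    ring
  simp_rw [h1]
  rw [intervalIntegral.integral_comp_mul_left (fun θ => h (circleMap 0 r θ)) (by positivity)]
  simp

variable {ι : Type*} [Fintype ι] [DecidableEq ι]

/-- The generalized Vandermonde determinant with exponents `e` at points of the unit circle. -/
noncomputable def circleVandermonde (e : ι → ℕ) (x : ι → UnitAddCircle) : ℂ :=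
  (Matrix.of fun j n => fourier (e n : ℤ) (x j)).det

lemma continuous_circleVandermonde (e : ι → ℕ) : Continuous (circleVandermonde e) := by
  refine Continuous.matrix_det ?_
  refine continuous_matrix fun j n => ?_
  exact (fourier (e n : ℤ)).continuous.comp (continuous_apply j)

lemma circleVandermonde_eq_sum (e : ι → ℕ) (x : ι → UnitAddCircle) :
    circleVandermonde e x
      = ∑ σ : Equiv.Perm ι, ((σ.sign : ℤ) : ℂ) * ∏ i, fourier (e (σ i) : ℤ) (x i) := by
  rw [circleVandermonde, ← Matrix.det_transpose, Matrix.det_apply']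
  rfl

/-- Distinct permutations differ in at least two places. This kills the cross terms in the one-point
marginal even though the test function occupies the coordinate `j`. -/
lemma exists_ne_apply_ne_of_perm_ne {σ τ : Equiv.Perm ι} (h : σ ≠ τ) (j : ι) :
    ∃ i, i ≠ j ∧ σ i ≠ τ i := by
  by_contra! hcon
  refine h (Equiv.ext fun i => ?_)
  by_cases hij : i = j
  · subst hij
    obtain ⟨k, hk⟩ := τ.surjective (σ i)
    by_cases hki : k = i
    · rw [← hk, hki]
    · exact absurd (σ.injective ((hcon k hki).trans hk)) hki
  · exact hcon i hij

/-- The one-point marginals of the density `|D|² / N!` are uniform. -/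
lemma integral_normSq_circleVandermonde_mul {e : ι → ℕ} (he : Function.Injective e)
    {h : UnitAddCircle → ℂ} (hh : Continuous h) (j : ι) :
    ∫ x, (circleVandermonde e x * starRingEnd ℂ (circleVandermonde e x)) * h (x j)
        ∂Measure.pi (fun _ : ι => AddCircle.haarAddCircle)
      = (Fintype.card ι).factorial * ∫ t, h t ∂AddCircle.haarAddCircle := by
  set g : Equiv.Perm ι → Equiv.Perm ι → ι → UnitAddCircle → ℂ := fun σ τ i t =>
    fourier ((e (σ i) : ℤ) + -(e (τ i) : ℤ)) t * (if i = j then h t else 1) with hg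
  have hgc : ∀ σ τ i, Continuous (g σ τ i) := fun σ τ i => by
    refine (fourier _).continuous.mul ?_
    split_ifs
    · exact hh
    · exact continuous_const
  have hexp : ∀ x : ι → UnitAddCircle,
      (circleVandermonde e x * starRingEnd ℂ (circleVandermonde e x)) * h (x j)
        = ∑ σ : Equiv.Perm ι, ∑ τ : Equiv.Perm ι,
            (((σ.sign : ℤ) : ℂ) * ((τ.sign : ℤ) : ℂ)) * ∏ i, g σ τ i (x i) := by
    intro x
    rw [circleVandermonde_eq_sum, map_sum, Finset.sum_mul_sum, Finset.sum_mul]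
    refine Finset.sum_congr rfl fun σ _ => ?_
    rw [Finset.sum_mul]
    refine Finset.sum_congr rfl fun τ _ => ?_
    simp only [hg, fourier_add, fourier_neg, Finset.prod_mul_distrib, map_mul, map_prod,
      Finset.prod_ite_eq', Finset.mem_univ, if_true, map_intCast]
    ring
  have hint : ∀ σ τ : Equiv.Perm ι, Integrable (fun x : ι → UnitAddCircle =>
      (((σ.sign : ℤ) : ℂ) * ((τ.sign : ℤ) : ℂ)) * ∏ i, g σ τ i (x i))
      (Measure.pi fun _ : ι => AddCircle.haarAddCircle) := fun σ τ => by
    refine Continuous.integrable_of_hasCompactSupport ?_ (HasCompactSupport.of_compactSpace _)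
    exact continuous_const.mul
      (continuous_finsetProd _ fun i _ => (hgc σ τ i).comp (continuous_apply i))
  simp_rw [hexp]
  rw [integral_finsetSum _ fun σ _ => integrable_finsetSum _ fun τ _ => hint σ τ]
  have hterm : ∀ σ : Equiv.Perm ι, ∫ x, ∑ τ : Equiv.Perm ι,
      (((σ.sign : ℤ) : ℂ) * ((τ.sign : ℤ) : ℂ)) * ∏ i, g σ τ i (x i)
        ∂Measure.pi (fun _ : ι => AddCircle.haarAddCircle) = ∫ t, h t ∂AddCircle.haarAddCircle := by
    intro σ
    rw [integral_finsetSum _ fun τ _ => hint σ τ, Finset.sum_eq_single σ]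
    · rw [integral_const_mul, integral_fintype_prod_eq_prod, ← Finset.mul_prod_erase _ _
        (Finset.mem_univ j), Finset.prod_eq_one]
      · have : (((σ.sign : ℤ) : ℂ) * ((σ.sign : ℤ) : ℂ)) = 1 := by
          rw [← Int.cast_mul, ← Units.val_mul, Int.units_mul_self]
          simp
        rw [this]
        simp only [hg, add_neg_cancel, fourier_zero, if_true, one_mul, mul_one]
      · intro i hi
        simp only [hg, add_neg_cancel, fourier_zero, Finset.ne_of_mem_erase hi, if_false, mul_one,
          integral_const, probReal_univ, one_smul]
    · intro τ _ hτ
      obtain ⟨i, hij, hi⟩ := exists_ne_apply_ne_of_perm_ne hτ.symm j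
      rw [integral_const_mul, integral_fintype_prod_eq_prod,
        Finset.prod_eq_zero (Finset.mem_univ i), mul_zero]
      simp only [hg, hij, if_false, mul_one]
      rw [integral_fourier_haarAddCircle, if_neg]
      intro h0
      refine hi (he ?_)
      have : (e (σ i) : ℤ) = e (τ i) := by linarith
      exact_mod_cast this
    · simp
  rw [Finset.sum_congr rfl fun σ _ => hterm σ, Finset.sum_const, Finset.card_univ,
    Fintype.card_perm, nsmul_eq_mul]

lemma integral_norm_circleVandermonde_sq_mul {e : ι → ℕ} (he : Function.Injective e)
    {u : UnitAddCircle → ℝ} (hu : Continuous u) (j : ι) :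
    ∫ x, ‖circleVandermonde e x‖ ^ 2 * u (x j)
        ∂Measure.pi (fun _ : ι => AddCircle.haarAddCircle)
      = (Fintype.card ι).factorial * ∫ t, u t ∂AddCircle.haarAddCircle := by
  have h := integral_normSq_circleVandermonde_mul he
    (h := fun t => (u t : ℂ)) (Complex.continuous_ofReal.comp hu) j
  simp_rw [Complex.mul_conj'] at h
  rw [integral_complex_ofReal] at h
  rw [← Complex.ofReal_inj, ← integral_complex_ofReal]
  push_cast
  exact h

/-- Jensen's inequality for the exponential under `|D|² / N!`: since all marginals are uniform, the
mean of `∑ u (x j)` is `N ∫ u`. -/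
lemma exp_neg_mul_integral_le {e : ι → ℕ} (he : Function.Injective e) [Nonempty ι]
    {u : UnitAddCircle → ℝ} (hu : Continuous u) (s : ℝ) :
    Real.exp (-(s * Fintype.card ι * ∫ t, u t ∂AddCircle.haarAddCircle))
      ≤ ∫ x, ‖circleVandermonde e x‖ ^ 2 / (Fintype.card ι).factorial
          * Real.exp (-(s * ∑ j, u (x j))) ∂Measure.pi (fun _ : ι => AddCircle.haarAddCircle) := by
  set M := ∫ t, u t ∂(AddCircle.haarAddCircle : Measure UnitAddCircle) with hM
  set m := -(s * Fintype.card ι * M) with hm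
  have hfac : (0 : ℝ) < (Fintype.card ι).factorial := by positivity
  have hint : ∀ F : (ι → UnitAddCircle) → ℝ, Continuous F →
      Integrable F (Measure.pi fun _ : ι => AddCircle.haarAddCircle) := fun F hF =>
    hF.integrable_of_hasCompactSupport (HasCompactSupport.of_compactSpace _)
  have hD := continuous_circleVandermonde e
  have huj : ∀ j, Continuous fun x : ι → UnitAddCircle => u (x j) := fun j =>
    hu.comp (continuous_apply j)
  -- The tangent line of `exp` at the mean `m`, integrated against the density, gives exactly `exp
  -- m`.
  have hlow : ∫ x, (‖circleVandermonde e x‖ ^ 2 / (Fintype.card ι).factorial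
      * (Real.exp m * (1 - m)) - Real.exp m * s / (Fintype.card ι).factorial
        * ∑ j, ‖circleVandermonde e x‖ ^ 2 * u (x j))
        ∂Measure.pi (fun _ : ι => AddCircle.haarAddCircle) = Real.exp m := by
    rw [integral_sub (hint _ (by fun_prop)) (hint _ (by fun_prop)), integral_mul_const,
      integral_div, integral_const_mul, integral_finsetSum _ fun j _ => hint _ (by fun_prop)]
    have h1 := integral_norm_circleVandermonde_sq_mul he (u := fun _ => 1) continuous_const
      (Classical.arbitrary ι)
    simp only [mul_one, integral_const, probReal_univ, smul_eq_mul] at h1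
    rw [h1, Finset.sum_congr rfl fun j _ => integral_norm_circleVandermonde_sq_mul he hu j,
      Finset.sum_const, Finset.card_univ, nsmul_eq_mul, ← hM, hm]
    field_simp
    ring
  rw [← hlow]
  refine integral_mono (hint _ (by fun_prop)) (hint _ (by fun_prop)) fun x => ?_
  dsimp only
  rw [← Finset.mul_sum]
  have hexp : Real.exp m * (1 - m - s * ∑ j, u (x j)) ≤ Real.exp (-(s * ∑ j, u (x j))) := by
    have h2 := Real.add_one_le_exp (-(s * ∑ j, u (x j)) - m)
    have h3 : Real.exp (-(s * ∑ j, u (x j)))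
        = Real.exp m * Real.exp (-(s * ∑ j, u (x j)) - m) := by
      rw [← Real.exp_add]; congr 1; ring
    rw [h3]
    gcongr
    linarith
  calc _ = ‖circleVandermonde e x‖ ^ 2 / (Fintype.card ι).factorial
      * (Real.exp m * (1 - m - s * ∑ j, u (x j))) := by ring
    _ ≤ _ := by gcongr

/-- If `f` is zero-free in the closed disk, then the average of `∏ |f(z_j)|^{-s}` with respect to
the density `|D|² / N!` is at least `|f(0)|^{-sN}`. -/
lemma rpow_norm_apply_zero_le {e : ι → ℕ} (he : Function.Injective e) [Nonempty ι]
    {f : ℂ → ℂ} (hf : Differentiable ℂ f) {r : ℝ} (hr : 0 ≤ r)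
    (hf0 : ∀ z : ℂ, ‖z‖ ≤ r → f z ≠ 0) (s : ℝ) :
    ENNReal.ofReal (‖f 0‖ ^ (-(s * Fintype.card ι)))
      ≤ ∫⁻ x, ENNReal.ofReal (‖circleVandermonde e x‖ ^ 2 / (Fintype.card ι).factorial)
          * ∏ j, ENNReal.ofReal (‖f (r * fourier 1 (x j))‖ ^ (-s))
          ∂Measure.pi (fun _ : ι => AddCircle.haarAddCircle) := by
  have hnorm : ∀ t : UnitAddCircle, ‖(r : ℂ) * fourier 1 t‖ ≤ r := fun t => by
    rw [norm_mul, fourier_apply, Circle.norm_coe, mul_one, Complex.norm_real,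
      Real.norm_of_nonneg hr]
  have hne : ∀ t : UnitAddCircle, f (r * fourier 1 t) ≠ 0 := fun t => hf0 _ (hnorm t)
  have hcont : Continuous fun t : UnitAddCircle => f (r * fourier 1 t) :=
    hf.continuous.comp (continuous_const.mul (fourier 1).continuous)
  have hu : Continuous fun t : UnitAddCircle => Real.log ‖f (r * fourier 1 t)‖ :=
    hcont.norm.log fun t => norm_ne_zero_iff.2 (hne t)
  have h := exp_neg_mul_integral_le he hu s
  -- The mean value property of the harmonic function `log ‖f‖`; this is where the absence of zeros
  -- enters.
  have hmean : ∫ t, Real.log ‖f (r * fourier 1 t)‖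
      ∂(AddCircle.haarAddCircle : Measure UnitAddCircle) = Real.log ‖f 0‖ := by
    rw [integral_unitAddCircle_eq_circleAverage (fun z => Real.log ‖f z‖) r]
    refine AnalyticOnNhd.circleAverage_log_norm_of_ne_zero (fun z _ => hf.analyticAt z) ?_
    intro z hz
    rw [abs_of_nonneg hr, mem_closedBall_zero_iff] at hz
    exact hf0 z hz
  have h0 : 0 < ‖f 0‖ := norm_pos_iff.2 (hf0 0 (by simpa using hr))
  rw [hmean] at h
  have hleft : ‖f 0‖ ^ (-(s * Fintype.card ι))
      = Real.exp (-(s * Fintype.card ι * Real.log ‖f 0‖)) := by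
    rw [Real.rpow_def_of_pos h0]; congr 1; ring
  have hright : ∀ x : ι → UnitAddCircle, Real.exp (-(s * ∑ j, Real.log ‖f (r * fourier 1 (x j))‖))
      = ∏ j, ‖f (r * fourier 1 (x j))‖ ^ (-s) := fun x => by
    rw [Finset.mul_sum, ← Finset.sum_neg_distrib, Real.exp_sum]
    refine Finset.prod_congr rfl fun j _ => ?_
    rw [Real.rpow_def_of_pos (norm_pos_iff.2 (hne _))]; congr 1; ring
  have hcont' : Continuous fun x : ι → UnitAddCircle =>
      ‖circleVandermonde e x‖ ^ 2 / (Fintype.card ι).factorial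
          * Real.exp (-(s * ∑ j, Real.log ‖f (r * fourier 1 (x j))‖)) := by
    have hD := continuous_circleVandermonde e
    have huj : ∀ j, Continuous fun x : ι → UnitAddCircle => Real.log ‖f (r * fourier 1 (x j))‖ :=
      fun j => hu.comp (continuous_apply j)
    have hsum : Continuous fun x : ι → UnitAddCircle =>
        ∑ j, Real.log ‖f (r * fourier 1 (x j))‖ := continuous_finsetSum _ fun j _ => huj j
    fun_prop
  rw [hleft]
  refine (ENNReal.ofReal_le_ofReal h).trans (le_of_eq ?_)
  rw [ofReal_integral_eq_lintegral_ofReal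
    (hcont'.integrable_of_hasCompactSupport (HasCompactSupport.of_compactSpace _))
    (ae_of_all _ fun x => by positivity)]
  refine lintegral_congr fun x => ?_
  rw [hright, ENNReal.ofReal_mul (by positivity),
    ENNReal.ofReal_prod_of_nonneg fun j _ => by positivity]

end Determinantal

/-! ### Affine change of variables in `ℂ^N`. -/

section ChangeOfVariables

variable {ι : Type*} [Fintype ι] [DecidableEq ι]

/-- The real Jacobian of a complex linear map is `|det|²`, and translation invariance removes `b`.
With the determinant kept as a factor, singular matrices are allowed; they arise when points
coincide. -/
lemma normSq_det_mul_lintegral_prod_le (M : Matrix ι ι ℂ) (b : ι → ℂ) {φ : ℂ → ℝ}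
    (hφ : Integrable φ) (hφm : Measurable φ) (hφ0 : ∀ w, 0 ≤ φ w) :
    ENNReal.ofReal (‖M.det‖ ^ 2) * ∫⁻ x : ι → ℂ, ∏ j, ENNReal.ofReal (φ (M.mulVec x j + b j))
      ≤ ENNReal.ofReal (∫ w, φ w) ^ Fintype.card ι := by
  by_cases hM : M.det = 0
  · simp [hM]
  have hMn : 0 < ‖M.det‖ ^ 2 := by positivity
  set f : (ι → ℂ) →ₗ[ℝ] (ι → ℂ) := (Matrix.toLin' M).restrictScalars ℝ with hf
  have hdet : LinearMap.det f = ‖M.det‖ ^ 2 := by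
    rw [hf, LinearMap.det_restrictScalars, Algebra.norm_complex_apply, LinearMap.det_toLin',
      Complex.normSq_eq_norm_sq]
  have hG : Measurable fun y : ι → ℂ => ∏ j, ENNReal.ofReal (φ (y j + b j)) := by fun_prop
  have hfm : Measurable f := (LinearMap.continuous_of_finiteDimensional f).measurable
  have h1 : ∫⁻ x : ι → ℂ, ∏ j, ENNReal.ofReal (φ (M.mulVec x j + b j))
      = ∫⁻ y, ∏ j, ENNReal.ofReal (φ (y j + b j)) ∂Measure.map f volume := by
    rw [lintegral_map hG hfm]
    rfl
  have h2 : ∫⁻ y : ι → ℂ, ∏ j, ENNReal.ofReal (φ (y j + b j))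
      = ENNReal.ofReal (∫ w, φ w) ^ Fintype.card ι := by
    refine (lintegral_add_right_eq_self (fun y : ι → ℂ => ∏ j, ENNReal.ofReal (φ (y j))) b).trans ?_
    simp_rw [← ENNReal.ofReal_prod_of_nonneg fun j _ => hφ0 _]
    rw [volume_pi, ← ofReal_integral_eq_lintegral_ofReal
      (Integrable.fintype_prod (f := fun _ => φ) fun _ => hφ)
      (ae_of_all _ fun x => Finset.prod_nonneg fun j _ => hφ0 _),
      integral_fintype_prod_eq_prod (𝕜 := ℝ) (fun _ => φ), Finset.prod_const, Finset.card_univ,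
      ENNReal.ofReal_pow (integral_nonneg hφ0)]
  rw [h1, Measure.map_linearMap_addHaar_eq_smul_addHaar volume (by rw [hdet]; exact hMn.ne'),
    lintegral_smul_measure, h2, hdet, smul_eq_mul, ← mul_assoc, ← ENNReal.ofReal_mul hMn.le,
    abs_of_nonneg (inv_nonneg.2 hMn.le), mul_inv_cancel₀ hMn.ne', ENNReal.ofReal_one, one_mul]

lemma normSq_det_mul_lintegral_gaussian_le [SigmaFinite stdComplexGaussian] (M : Matrix ι ι ℂ)
    (b : ι → ℂ) {φ : ℂ → ℝ} (hφ : Integrable φ) (hφm : Measurable φ) (hφ0 : ∀ w, 0 ≤ φ w) :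
    ENNReal.ofReal (‖M.det‖ ^ 2) * ∫⁻ x : ι → ℂ, ∏ j, ENNReal.ofReal (φ (M.mulVec x j + b j))
        ∂Measure.pi (fun _ => stdComplexGaussian)
      ≤ ENNReal.ofReal (Real.pi⁻¹ * ∫ w, φ w) ^ Fintype.card ι := by
  have h := lintegral_mono' (Measure.pi_const_le_smul (ι := ι) ENNReal.ofReal_ne_top
    stdComplexGaussian_le_smul_volume)
    (le_refl fun x : ι → ℂ => ∏ j, ENNReal.ofReal (φ (M.mulVec x j + b j)))
  rw [lintegral_smul_measure, smul_eq_mul, ← volume_pi] at h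
  calc _ ≤ ENNReal.ofReal (‖M.det‖ ^ 2) * (ENNReal.ofReal Real.pi⁻¹ ^ Fintype.card ι
        * ∫⁻ x : ι → ℂ, ∏ j, ENNReal.ofReal (φ (M.mulVec x j + b j))) := by gcongr
    _ = ENNReal.ofReal Real.pi⁻¹ ^ Fintype.card ι * (ENNReal.ofReal (‖M.det‖ ^ 2)
        * ∫⁻ x : ι → ℂ, ∏ j, ENNReal.ofReal (φ (M.mulVec x j + b j))) := by ring
    _ ≤ ENNReal.ofReal Real.pi⁻¹ ^ Fintype.card ι
        * ENNReal.ofReal (∫ w, φ w) ^ Fintype.card ι := by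
      gcongr
      exact normSq_det_mul_lintegral_prod_le M b hφ hφm hφ0
    _ = _ := by rw [← mul_pow, ← ENNReal.ofReal_mul (by positivity)]

end ChangeOfVariables

/-! ### The integral of the truncated power, by polar coordinates. -/

section TruncatedPower

/-- The function `|w|^{-s}` truncated to the disk `|w| < R`. -/
noncomputable def truncatedNegPow (s R : ℝ) (w : ℂ) : ℝ :=
  if ‖w‖ < R then ‖w‖ ^ (-s) else 0

lemma truncatedNegPow_nonneg (s R : ℝ) (w : ℂ) : 0 ≤ truncatedNegPow s R w := by
  rw [truncatedNegPow]
  split_ifs <;> positivity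

lemma measurable_truncatedNegPow (s R : ℝ) : Measurable (truncatedNegPow s R) :=
  Measurable.ite (measurableSet_lt measurable_norm measurable_const) (by fun_prop)
    measurable_const

lemma truncatedNegPow_radial_eq {s R y : ℝ} (hy : 0 < y) :
    y ^ (Module.finrank ℝ ℂ - 1) • (if y < R then y ^ (-s) else 0)
      = Set.indicator (Set.Ioo 0 R) (fun y => y ^ (1 - s)) y := by
  rw [Complex.finrank_real_complex, Set.indicator]
  by_cases h : y < R
  · rw [if_pos h, if_pos (Set.mem_Ioo.2 ⟨hy, h⟩), smul_eq_mul, Real.rpow_sub hy,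
      Real.rpow_neg hy.le]
    simp [div_eq_mul_inv]
  · rw [if_neg h, if_neg fun h' => h (Set.mem_Ioo.1 h').2, smul_zero]

lemma integrable_truncatedNegPow {s R : ℝ} (hs : s < 2) (hR : 0 ≤ R) :
    Integrable (truncatedNegPow s R) := by
  have h := integrable_fun_norm_addHaar (volume : Measure ℂ)
    (f := fun y : ℝ => if y < R then y ^ (-s) else 0)
  refine h.2 ?_
  rw [integrableOn_congr_fun (fun y (hy : y ∈ Set.Ioi 0) =>
    truncatedNegPow_radial_eq (Set.mem_Ioi.1 hy)) measurableSet_Ioi]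
  refine (IntegrableOn.integrable_indicator ?_ measurableSet_Ioo).integrableOn
  have := intervalIntegral.intervalIntegrable_rpow' (a := 0) (b := R) (r := 1 - s) (by linarith)
  rw [intervalIntegrable_iff_integrableOn_Ioo_of_le hR] at this
  exact this

lemma integral_truncatedNegPow {s R : ℝ} (hs : s < 2) (hR : 0 ≤ R) :
    ∫ w, truncatedNegPow s R w = 2 * Real.pi * (R ^ (2 - s) / (2 - s)) := by
  have h := integral_fun_norm_addHaar (volume : Measure ℂ)
    (fun y : ℝ => if y < R then y ^ (-s) else 0)
  have hball : (volume : Measure ℂ).real (Metric.ball 0 1) = Real.pi := by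
    rw [Measure.real, Complex.volume_ball]
    simp
  have hint : ∫ y in Set.Ioi (0 : ℝ), y ^ (Module.finrank ℝ ℂ - 1) • (if y < R then y ^ (-s) else 0)
      = R ^ (2 - s) / (2 - s) := by
    rw [setIntegral_congr_fun measurableSet_Ioi fun y hy => truncatedNegPow_radial_eq hy,
      setIntegral_indicator measurableSet_Ioo,
      Set.inter_eq_self_of_subset_right Set.Ioo_subset_Ioi_self, ← integral_Ioc_eq_integral_Ioo,
      ← intervalIntegral.integral_of_le hR, integral_rpow (Or.inl (by linarith)),
      show 1 - s + 1 = 2 - s by ring, Real.zero_rpow (by linarith), sub_zero]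
  rw [hint, hball, Complex.finrank_real_complex] at h
  refine Eq.trans h ?_
  simp only [nsmul_eq_mul, smul_eq_mul]
  push_cast
  ring

end TruncatedPower

/-! ### The expectation over the coefficients for fixed points. -/

section UpperBound

variable {Ω : Type*} [MeasurableSpace Ω] {μ : Measure Ω} {ξ : ℕ → Ω → ℂ} {a : ℕ → ℂ}

lemma measurable_randomTaylor (hm : ∀ n, Measurable (ξ n)) :
    Measurable fun p : Ω × ℂ => randomTaylor a ξ p.1 p.2 := by
  refine Measurable.tsum fun n => ?_
  exact (((hm n).comp measurable_fst).const_mul _).mul (measurable_snd.pow_const n)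

lemma differentiable_randomTaylor {Ω : Type*} {ξ : ℕ → Ω → ℂ} {ω : Ω}
    (hω : ∀ r : ℝ, 0 ≤ r → Summable fun n => ‖a n‖ * ‖ξ n ω‖ * r ^ n) :
    Differentiable ℂ (randomTaylor a ξ ω) := by
  intro z
  have hd : DifferentiableOn ℂ (fun z => ∑' n, a n * ξ n ω * z ^ n) (Metric.ball 0 (‖z‖ + 1)) := by
    refine Complex.differentiableOn_tsum_of_summable_norm (hω (‖z‖ + 1) (by positivity))
      (fun n => by fun_prop) Metric.isOpen_ball fun n w hw => ?_
    rw [norm_mul, norm_mul, norm_pow]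
    have := (mem_ball_zero_iff.1 hw).le
    gcongr
  exact hd.differentiableAt (Metric.isOpen_ball.mem_nhds (by simp))

/-- The determinant of the change of variables cancels the density `|D|²`. -/
lemma normSq_circleVandermonde_mul_lintegral_le [IsProbabilityMeasure μ]
    (ha : ∀ z : ℂ, Summable fun n => a n * z ^ n) (hm : ∀ n, Measurable (ξ n))
    (hind : iIndepFun ξ μ) (hlaw : ∀ n, μ.map (ξ n) = stdComplexGaussian) {r : ℝ} (hr : 0 < r)
    (A : Finset ℕ) {φ : ℂ → ℝ} (hφ : Integrable φ) (hφm : Measurable φ) (hφ0 : ∀ w, 0 ≤ φ w)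
    (x : ↥(A : Set ℕ) → UnitAddCircle) :
    ENNReal.ofReal (‖circleVandermonde (fun n : ↥(A : Set ℕ) => (n : ℕ)) x‖ ^ 2)
        * ENNReal.ofReal (∏ n ∈ A, (‖a n‖ * r ^ n) ^ 2)
        * ∫⁻ ω, ∏ j, ENNReal.ofReal (φ (randomTaylor a ξ ω (r * fourier 1 (x j)))) ∂μ
      ≤ ENNReal.ofReal (Real.pi⁻¹ * ∫ w, φ w) ^ A.card := by
  have hprob : IsProbabilityMeasure stdComplexGaussian := by
    rw [← hlaw 0]; exact Measure.isProbabilityMeasure_map (hm 0).aemeasurable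
  set X : Ω → ↥(A : Set ℕ) → ℂ := fun ω i => ξ i ω with hX
  set Y : Ω → ↥((A : Set ℕ)ᶜ) → ℂ := fun ω i => ξ i ω with hY
  have hXm : Measurable X := measurable_pi_lambda _ fun i => hm i
  have hYm : Measurable Y := measurable_pi_lambda _ fun i => hm i
  have hXlaw : μ.map X = Measure.pi fun _ : ↥(A : Set ℕ) => stdComplexGaussian := by
    have h1 : iIndepFun (fun (i : ↥(A : Set ℕ)) => ξ i) μ := hind.precomp Subtype.val_injective
    have h2 := (iIndepFun_iff_map_fun_eq_pi_map fun i : ↥(A : Set ℕ) => (hm i).aemeasurable).1 h1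
    rw [hX, h2]
    simp_rw [hlaw]
  have hXY : μ.map (fun ω => (X ω, Y ω))
      = (Measure.pi fun _ : ↥(A : Set ℕ) => stdComplexGaussian).prod (μ.map Y) := by
    rw [← hXlaw]
    exact (indepFun_iff_map_prod_eq_prod_map_map hXm.aemeasurable hYm.aemeasurable).1
      (hind.indepFun_of_disjoint hm disjoint_compl_right)
  set z : ↥(A : Set ℕ) → ℂ := fun j => r * fourier 1 (x j) with hz
  -- The Vandermonde matrix with columns scaled by `aₙ rⁿ`: it sends the coefficients in `A` to
  -- their contribution to `f(z_j)`. The other coefficients enter only through the shift `g`, and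
  -- the bound is uniform in it.
  set M : Matrix ↥(A : Set ℕ) ↥(A : Set ℕ) ℂ := Matrix.of fun j n => (a n * (r : ℂ) ^ (n : ℕ)) *
    (Matrix.of fun (j n : ↥(A : Set ℕ)) => fourier ((n : ℕ) : ℤ) (x j)) j n with hM
  set g : (↥((A : Set ℕ)ᶜ) → ℂ) → ↥(A : Set ℕ) → ℂ := fun y j => ∑' n : ↥((A : Set ℕ)ᶜ), a n * y n * z j ^ (n : ℕ) with hg
  have hgm : ∀ j, Measurable fun y => g y j := fun j =>
    Measurable.tsum fun n => ((measurable_pi_apply n).const_mul _).mul_const _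
  have hMz : ∀ j n, M j n = a n * z j ^ (n : ℕ) := fun j n => by
    simp only [hM, hz, Matrix.of_apply, mul_pow, mul_assoc, fourier_apply, one_smul,
      natCast_zsmul, AddCircle.toCircle_nsmul, Circle.coe_pow]
  have hsplit : ∀ᵐ ω ∂μ, ∀ j, randomTaylor a ξ ω (z j) = M.mulVec (X ω) j + g (Y ω) j := by
    filter_upwards [ae_summable_randomTaylor ha hm hlaw] with ω hω j
    rw [randomTaylor, ← (hω (z j)).sum_add_tsum_compl (s := A)]
    congr 1
    rw [Matrix.mulVec, dotProduct, ← Finset.sum_coe_sort]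
    refine Finset.sum_congr rfl fun n _ => ?_
    rw [hMz]
    ring
  have hdet : ‖M.det‖ ^ 2
      = ‖circleVandermonde (fun n : ↥(A : Set ℕ) => (n : ℕ)) x‖ ^ 2 * ∏ n ∈ A, (‖a n‖ * r ^ n) ^ 2 := by
    rw [hM, Matrix.det_mul_row (fun n : ↥(A : Set ℕ) => a n * (r : ℂ) ^ (n : ℕ)), norm_mul, norm_prod,
      ← circleVandermonde, mul_pow, mul_comm, ← Finset.prod_pow]
    congr 1
    refine Eq.trans (Finset.prod_congr rfl fun n _ => ?_)
      (Finset.prod_coe_sort A fun n => (‖a n‖ * r ^ n) ^ 2)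
    rw [norm_mul, norm_pow, Complex.norm_real, Real.norm_of_nonneg hr.le]
  set H : (↥(A : Set ℕ) → ℂ) × (↥((A : Set ℕ)ᶜ) → ℂ) → ENNReal :=
    fun p => ∏ j, ENNReal.ofReal (φ (M.mulVec p.1 j + g p.2 j)) with hH
  have hHm : Measurable H := by
    refine Finset.measurable_fun_prod _ fun j _ => (hφm.comp ?_).ennreal_ofReal
    refine Measurable.add ?_ ((hgm j).comp measurable_snd)
    simp only [Matrix.mulVec, dotProduct]
    fun_prop
  have hint : ∫⁻ ω, ∏ j, ENNReal.ofReal (φ (randomTaylor a ξ ω (z j))) ∂μ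
      = ∫⁻ y, ∫⁻ v, H (v, y) ∂(Measure.pi fun _ : ↥(A : Set ℕ) => stdComplexGaussian) ∂(μ.map Y) := by
    rw [← lintegral_prod_symm' _ hHm, ← hXY, lintegral_map hHm (hXm.prodMk hYm)]
    refine lintegral_congr_ae ?_
    filter_upwards [hsplit] with ω hω
    simp only [hH, hω]
  have hcard : Fintype.card ↥(A : Set ℕ) = A.card := by simp
  have hYprob : IsProbabilityMeasure (μ.map Y) := Measure.isProbabilityMeasure_map hYm.aemeasurable
  rw [← ENNReal.ofReal_mul (by positivity), ← hdet, hint, ← lintegral_const_mul' _ _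
    ENNReal.ofReal_ne_top, ← hcard]
  calc _ ≤ ∫⁻ _, ENNReal.ofReal (Real.pi⁻¹ * ∫ w, φ w) ^ Fintype.card ↥(A : Set ℕ) ∂(μ.map Y) :=
        lintegral_mono fun y => normSq_det_mul_lintegral_gaussian_le M (g y) hφ hφm hφ0
    _ = _ := by simp

end UpperBound

/-! ### Markov's inequality for the determinantal average. -/

section HoleProbability

variable {Ω : Type*} [MeasurableSpace Ω] {μ : Measure Ω} {ξ : ℕ → Ω → ℂ} {a : ℕ → ℂ}

/-- The average over the determinantal density of `∏ |f(z_j)|^{-s}`, truncated to `|f| < R`. -/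
noncomputable def determinantalAverage (a : ℕ → ℂ) (ξ : ℕ → Ω → ℂ) (A : Finset ℕ) (r s R : ℝ)
    (ω : Ω) : ENNReal :=
  ∫⁻ x, ENNReal.ofReal (‖circleVandermonde (fun n : ↥(A : Set ℕ) => (n : ℕ)) x‖ ^ 2
      / (Fintype.card ↥(A : Set ℕ)).factorial)
    * ∏ j, ENNReal.ofReal (truncatedNegPow s R (randomTaylor a ξ ω (r * fourier 1 (x j))))
    ∂Measure.pi (fun _ : ↥(A : Set ℕ) => AddCircle.haarAddCircle)

lemma measurable_determinantalIntegrand (hm : ∀ n, Measurable (ξ n)) (A : Finset ℕ) (r s R : ℝ) :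
    Measurable fun p : Ω × (↥(A : Set ℕ) → UnitAddCircle) =>
      ENNReal.ofReal (‖circleVandermonde (fun n : ↥(A : Set ℕ) => (n : ℕ)) p.2‖ ^ 2
        / (Fintype.card ↥(A : Set ℕ)).factorial)
      * ∏ j, ENNReal.ofReal (truncatedNegPow s R
          (randomTaylor a ξ p.1 (r * fourier 1 (p.2 j)))) := by
  have hD := (continuous_circleVandermonde fun n : ↥(A : Set ℕ) => (n : ℕ)).measurable
  refine Measurable.mul ?_ (Finset.measurable_fun_prod _ fun j _ => ?_)
  · exact (((hD.comp measurable_snd).norm.pow_const 2).div_const _).ennreal_ofReal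
  · refine ((measurable_truncatedNegPow s R).comp
      ((measurable_randomTaylor hm).comp (measurable_fst.prodMk ?_))).ennreal_ofReal
    exact ((fourier 1).continuous.measurable.comp
      ((measurable_pi_apply j).comp measurable_snd)).const_mul _

lemma measurable_determinantalAverage (hm : ∀ n, Measurable (ξ n)) (A : Finset ℕ) (r s R : ℝ) :
    Measurable (determinantalAverage a ξ A r s R) :=
  (measurable_determinantalIntegrand hm A r s R).lintegral_prod_right'

lemma lintegral_determinantalAverage_le [IsProbabilityMeasure μ]
    (ha : ∀ z : ℂ, Summable fun n => a n * z ^ n) (hm : ∀ n, Measurable (ξ n))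
    (hind : iIndepFun ξ μ) (hlaw : ∀ n, μ.map (ξ n) = stdComplexGaussian) {r : ℝ} (hr : 0 < r)
    {A : Finset ℕ} (hA : ∀ n ∈ A, a n ≠ 0) {s R : ℝ} (hs : s < 2) (hR : 0 ≤ R) :
    ∫⁻ ω, determinantalAverage a ξ A r s R ω ∂μ
      ≤ ENNReal.ofReal ((2 * (R ^ (2 - s) / (2 - s))) ^ A.card / ∏ n ∈ A, (‖a n‖ * r ^ n) ^ 2) := by
  have hprod : 0 < ∏ n ∈ A, (‖a n‖ * r ^ n) ^ 2 :=
    Finset.prod_pos fun n hn => by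
      have := norm_pos_iff.2 (hA n hn)
      positivity
  have h2s : 0 < 2 - s := by linarith
  simp only [determinantalAverage]
  rw [lintegral_lintegral_swap (measurable_determinantalIntegrand hm A r s R).aemeasurable]
  calc _ ≤ ∫⁻ _, ENNReal.ofReal ((2 * (R ^ (2 - s) / (2 - s))) ^ A.card
          / ∏ n ∈ A, (‖a n‖ * r ^ n) ^ 2)
          ∂Measure.pi (fun _ : ↥(A : Set ℕ) => (AddCircle.haarAddCircle : Measure UnitAddCircle)) := by
        refine lintegral_mono fun x => ?_
        have h := normSq_circleVandermonde_mul_lintegral_le ha hm hind hlaw hr A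
          (integrable_truncatedNegPow hs hR) (measurable_truncatedNegPow s R)
          (truncatedNegPow_nonneg s R) x
        have hpi : Real.pi⁻¹ * ∫ w, truncatedNegPow s R w = 2 * (R ^ (2 - s) / (2 - s)) := by
          rw [integral_truncatedNegPow hs hR]
          field_simp
        rw [hpi] at h
        rw [lintegral_const_mul' _ _ ENNReal.ofReal_ne_top, ENNReal.ofReal_div_of_pos hprod,
          ENNReal.ofReal_pow (by positivity),
          ENNReal.le_div_iff_mul_le (Or.inl (by simpa using hprod)) (Or.inl ENNReal.ofReal_ne_top)]
        refine le_trans ?_ h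
        rw [mul_right_comm]
        gcongr
        exact div_le_self (by positivity) (by exact_mod_cast Nat.factorial_pos _)
    _ = _ := by simp

/-- A zero-free disk forces the determinantal average to be large. -/
lemma le_determinantalAverage {Ω : Type*} {ξ : ℕ → Ω → ℂ} {A : Finset ℕ} (hA : A.Nonempty) {r s R b : ℝ} (hr : 0 < r)
    (hs : 0 ≤ s) {ω : Ω}
    (hω : ∀ r : ℝ, 0 ≤ r → Summable fun n => ‖a n‖ * ‖ξ n ω‖ * r ^ n)
    (hhole : ∀ z : ℂ, ‖z‖ ≤ r → randomTaylor a ξ ω z ≠ 0)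
    (hb : ‖a 0‖ * ‖ξ 0 ω‖ ≤ b)
    (hbound : ∑' n, ENNReal.ofReal (‖a n‖ * r ^ n) * ‖ξ n ω‖ₑ < ENNReal.ofReal R) :
    ENNReal.ofReal (b ^ (-(s * A.card))) ≤ determinantalAverage a ξ A r s R ω := by
  have hne : Nonempty ↥(A : Set ℕ) := hA.to_subtype
  have hcard : Fintype.card ↥(A : Set ℕ) = A.card := by simp
  have hf0 : randomTaylor a ξ ω 0 = a 0 * ξ 0 ω := by
    rw [randomTaylor, tsum_eq_single 0 fun n hn => by rw [zero_pow hn, mul_zero]]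
    simp
  have hpos : 0 < ‖randomTaylor a ξ ω 0‖ := norm_pos_iff.2 (hhole 0 (by simpa using hr.le))
  have h := rpow_norm_apply_zero_le (e := fun n : ↥(A : Set ℕ) => (n : ℕ))
    Subtype.val_injective (differentiable_randomTaylor hω) hr.le hhole s
  refine le_trans (ENNReal.ofReal_le_ofReal ?_) (h.trans (le_of_eq ?_))
  · rw [hcard]
    refine Real.rpow_le_rpow_of_nonpos hpos ?_ ?_
    · rwa [hf0, norm_mul]
    · have : 0 ≤ s * A.card := by positivity
      linarith
  · rw [determinantalAverage]
    refine lintegral_congr fun x => ?_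
    congr 1
    refine Finset.prod_congr rfl fun j _ => ?_
    rw [truncatedNegPow, if_pos]
    have hz : ‖(r : ℂ) * fourier 1 (x j)‖ = r := by
      rw [norm_mul, fourier_apply, Circle.norm_coe, mul_one, Complex.norm_real,
        Real.norm_of_nonneg hr.le]
    have h1 : ‖randomTaylor a ξ ω (r * fourier 1 (x j))‖ₑ < ENNReal.ofReal R := by
      refine lt_of_le_of_lt (enorm_tsum_le_tsum_enorm.trans
        (le_of_eq (tsum_congr fun n => ?_))) hbound
      rw [← ofReal_norm, ← ofReal_norm, ← ENNReal.ofReal_mul (by positivity), norm_mul, norm_mul,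
        norm_pow, hz, mul_right_comm]
    rw [← ofReal_norm] at h1
    exact (ENNReal.ofReal_lt_ofReal_iff_of_nonneg (norm_nonneg _)).1 h1

/-- A hole means that `|f(0)| > b`, or the majorant of `|f|` on the circle reaches `R`, or the
average is large. Truncation at `R` is needed since `|w|^{-s}` with `s < 2` is integrable at the
origin but not at infinity. -/
lemma measure_hole_le [IsProbabilityMeasure μ]
    (ha : ∀ z : ℂ, Summable fun n => a n * z ^ n) (hm : ∀ n, Measurable (ξ n))
    (hind : iIndepFun ξ μ) (hlaw : ∀ n, μ.map (ξ n) = stdComplexGaussian) {r : ℝ} (hr : 0 < r)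
    {A : Finset ℕ} (hA : ∀ n ∈ A, a n ≠ 0) (hAne : A.Nonempty) {s R b : ℝ} (hs0 : 0 ≤ s)
    (hs : s < 2) (hR : 0 < R) (hb : 0 < b) :
    μ {ω | ∀ z : ℂ, ‖z‖ ≤ r → randomTaylor a ξ ω z ≠ 0}
      ≤ μ {ω | b < ‖a 0‖ * ‖ξ 0 ω‖}
        + (∑' n, ENNReal.ofReal (‖a n‖ * r ^ n)) * (∫⁻ z, ‖z‖ₑ ∂stdComplexGaussian)
            / ENNReal.ofReal R
        + ENNReal.ofReal (b ^ (s * A.card) * ((2 * (R ^ (2 - s) / (2 - s))) ^ A.card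
            / ∏ n ∈ A, (‖a n‖ * r ^ n) ^ 2)) := by
  have hb' : 0 < b ^ (-(s * A.card)) := by positivity
  have hsub : μ {ω | ∀ z : ℂ, ‖z‖ ≤ r → randomTaylor a ξ ω z ≠ 0}
      ≤ μ (({ω | b < ‖a 0‖ * ‖ξ 0 ω‖}
        ∪ {ω | ENNReal.ofReal R ≤ ∑' n, ENNReal.ofReal (‖a n‖ * r ^ n) * ‖ξ n ω‖ₑ})
        ∪ {ω | ENNReal.ofReal (b ^ (-(s * A.card))) ≤ determinantalAverage a ξ A r s R ω}) := by
    refine measure_mono_ae ?_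
    filter_upwards [ae_summable_norm_mul_pow ha hm hlaw] with ω hω hhole
    by_cases h1 : b < ‖a 0‖ * ‖ξ 0 ω‖
    · exact Or.inl (Or.inl h1)
    by_cases h2 : ENNReal.ofReal R ≤ ∑' n, ENNReal.ofReal (‖a n‖ * r ^ n) * ‖ξ n ω‖ₑ
    · exact Or.inl (Or.inr h2)
    · exact Or.inr (le_determinantalAverage hAne hr hs0 hω hhole (not_lt.1 h1) (not_le.1 h2))
  refine hsub.trans ((measure_union_le _ _).trans (add_le_add ((measure_union_le _ _).trans
    (add_le_add le_rfl ?_)) ?_))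
  · refine (meas_ge_le_lintegral_div
      (Measurable.tsum fun n => (hm n).enorm.const_mul _).aemeasurable
      (by simpa using hR) ENNReal.ofReal_ne_top).trans ?_
    rw [lintegral_tsum_mul_enorm hm hlaw]
  · refine (meas_ge_le_lintegral_div (measurable_determinantalAverage hm A r s R).aemeasurable
      (by simpa using hb') ENNReal.ofReal_ne_top).trans ?_
    refine (ENNReal.div_le_div_right
      (lintegral_determinantalAverage_le ha hm hind hlaw hr hA hs hR.le) _).trans (le_of_eq ?_)
    rw [← ENNReal.ofReal_div_of_pos hb', Real.rpow_neg hb.le, div_inv_eq_mul, mul_comm]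

end HoleProbability

/-! ### Choice of parameters and the two-sided estimate. -/

section Asymptotics

variable {Ω : Type*} [MeasurableSpace Ω] {μ : Measure Ω} {ξ : ℕ → Ω → ℂ} {a : ℕ → ℂ}

lemma tsum_ofReal_le_of_finset (ha : ∀ z : ℂ, Summable fun n => a n * z ^ n) {r : ℝ} (hr : 0 ≤ r)
    {B : Finset ℕ} {L : ℝ} (hL : 0 ≤ L)
    (htail : ∑' n : ℕ, (if n ∈ B then 0 else ENNReal.ofReal (‖a n‖ * r ^ n)) ≤ ENNReal.ofReal L) :
    ∑' n : ℕ, ENNReal.ofReal (‖a n‖ * r ^ n)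
      ≤ ENNReal.ofReal (B.card * Real.exp (holeExponent a r) + L) := by
  have hterm : ∀ n, ‖a n‖ * r ^ n ≤ Real.exp (holeExponent a r) := fun n => by
    have h1 := two_mul_sum_posLog_le_holeExponent ha hr {n}
    rw [Finset.sum_singleton] at h1
    have h2 : 0 ≤ Real.posLog (‖a n‖ * r ^ n) := Real.posLog_nonneg
    rcases (mul_nonneg (norm_nonneg (a n)) (pow_nonneg hr n)).eq_or_lt with h | h
    · rw [← h]; positivity
    · rw [← Real.log_le_iff_le_exp h]
      have h3 : Real.log (‖a n‖ * r ^ n) ≤ Real.posLog (‖a n‖ * r ^ n) := le_max_right _ _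
      linarith
  calc ∑' n : ℕ, ENNReal.ofReal (‖a n‖ * r ^ n)
      ≤ ∑' n : ℕ, ((if n ∈ B then ENNReal.ofReal (Real.exp (holeExponent a r)) else 0)
          + (if n ∈ B then 0 else ENNReal.ofReal (‖a n‖ * r ^ n))) := by
        refine ENNReal.tsum_le_tsum fun n => ?_
        split_ifs
        · simpa using ENNReal.ofReal_le_ofReal (hterm n)
        · simp
    _ ≤ ENNReal.ofReal (B.card * Real.exp (holeExponent a r)) + ENNReal.ofReal L := by
        rw [ENNReal.tsum_add, tsum_eq_sum (s := B) fun n hn => if_neg hn,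
          Finset.sum_congr rfl fun n hn => if_pos hn, Finset.sum_const, ← ENNReal.ofReal_nsmul,
          nsmul_eq_mul]
        gcongr
    _ = _ := (ENNReal.ofReal_add (by positivity) hL).symm

lemma prod_sq_dominantIndices (ha : ∀ z : ℂ, Summable fun n => a n * z ^ n) {r : ℝ} (hr : 0 ≤ r) :
    ∏ n ∈ dominantIndices a r, (‖a n‖ * r ^ n) ^ 2 = Real.exp (holeExponent a r) := by
  rw [holeExponent_eq_sum ha hr subset_rfl, Finset.mul_sum, Real.exp_sum]
  refine Finset.prod_congr rfl fun n hn => ?_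
  rw [mem_dominantIndices ha hr] at hn
  rw [Real.posLog_eq_log (hn.trans (le_abs_self _)), two_mul, Real.exp_add,
    Real.exp_log (by linarith), sq]

lemma holeProb_le [IsProbabilityMeasure μ]
    (ha : ∀ z : ℂ, Summable fun n => a n * z ^ n) (ha0 : a 0 ≠ 0) (hm : ∀ n, Measurable (ξ n))
    (hind : iIndepFun ξ μ) (hlaw : ∀ n, μ.map (ξ n) = stdComplexGaussian) {r : ℝ} (hr : 0 < r)
    (hT : 1 ≤ holeExponent a r) {S : ℝ} (hS : 0 ≤ S)
    (hsum : ∑' n : ℕ, ENNReal.ofReal (‖a n‖ * r ^ n) ≤ ENNReal.ofReal S) :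
    holeProb μ a ξ r ≤ 2 * Real.exp (-holeExponent a r)
      + S * (∫⁻ z, ‖z‖ₑ ∂stdComplexGaussian).toReal * Real.exp (-(3 * holeExponent a r))
      + Real.exp (-holeExponent a r) * (max 1 (2 * holeExponent a r * ‖a 0‖) ^ 2
        * (2 * Real.exp 3 * holeExponent a r)) ^ (dominantIndices a r).card := by
  set T := holeExponent a r with hTdef
  set A := dominantIndices a r with hAdef
  have hT0 : 0 < T := by linarith
  have ha0' : 0 < ‖a 0‖ := norm_pos_iff.2 ha0
  have hA : ∀ n ∈ A, a n ≠ 0 := fun n hn h0 => by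
    rw [hAdef, mem_dominantIndices ha hr.le, h0, norm_zero, zero_mul] at hn
    linarith
  have hAne : A.Nonempty := by
    by_contra h
    rw [Finset.not_nonempty_iff_eq_empty] at h
    have := holeExponent_eq_sum ha hr.le (s := ∅) (by rw [← hAdef, h])
    simp only [Finset.sum_empty, mul_zero] at this
    linarith
  have hTinv : 0 < T⁻¹ := by positivity
  have hTinv1 : T⁻¹ ≤ 1 := inv_le_one_of_one_le₀ hT
  set b := 2 * T * ‖a 0‖ with hb
  have hb0 : 0 < b := by positivity
  -- With these choices `R^{2-s} = e^3` and `1/(2-s) = T`, so each of the `N` factors costs only a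
  -- power of `T`. Meanwhile `R = e^{3T}` still beats the majorant, whose mean is of order `T e^T`
  -- in the application.
  have h := measure_hole_le ha hm hind hlaw hr hA hAne (s := 2 - T⁻¹) (R := Real.exp (3 * T))
    (b := b) (by linarith) (by linarith) (Real.exp_pos _) hb0
  set m := ∫⁻ z, ‖z‖ₑ ∂stdComplexGaussian with hmdef
  have h1 : μ {ω | b < ‖a 0‖ * ‖ξ 0 ω‖} ≤ ENNReal.ofReal (2 * Real.exp (-T)) := by
    have hset : {ω | b < ‖a 0‖ * ‖ξ 0 ω‖} = ξ 0 ⁻¹' {z | 2 * T < ‖z‖} := by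
      ext ω
      simp only [Set.mem_ofPred_eq, Set.mem_preimage, hb]
      rw [mul_comm ‖a 0‖, mul_lt_mul_iff_left₀ ha0']
    have hms : MeasurableSet {z : ℂ | 2 * T < ‖z‖} := measurableSet_lt measurable_const measurable_norm
    rw [hset, ← Measure.map_apply (hm 0) hms, hlaw 0]
    refine (stdComplexGaussian_norm_gt_le (by positivity)).trans (ENNReal.ofReal_le_ofReal ?_)
    gcongr
    nlinarith
  have h2 : (∑' n, ENNReal.ofReal (‖a n‖ * r ^ n)) * m / ENNReal.ofReal (Real.exp (3 * T))
      ≤ ENNReal.ofReal (S * m.toReal * Real.exp (-(3 * T))) := by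
    rw [Real.exp_neg, ← div_eq_mul_inv, ENNReal.ofReal_div_of_pos (Real.exp_pos _),
      ENNReal.ofReal_mul hS, ENNReal.ofReal_toReal lintegral_enorm_stdComplexGaussian_lt_top.ne]
    gcongr
  have h3 : b ^ ((2 - T⁻¹) * A.card) * ((2 * (Real.exp (3 * T) ^ (2 - (2 - T⁻¹))
        / (2 - (2 - T⁻¹)))) ^ A.card / ∏ n ∈ A, (‖a n‖ * r ^ n) ^ 2)
      ≤ Real.exp (-T) * (max 1 b ^ 2 * (2 * Real.exp 3 * T)) ^ A.card := by
    rw [prod_sq_dominantIndices ha hr.le, ← hTdef, sub_sub_cancel, div_inv_eq_mul, ← Real.exp_mul,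
      mul_assoc 3 T, mul_inv_cancel₀ hT0.ne', mul_one, mul_pow (max 1 b ^ 2), Real.exp_neg,
      ← mul_assoc 2 (Real.exp 3)]
    have h4 : b ^ ((2 - T⁻¹) * A.card) ≤ (max 1 b ^ 2) ^ A.card := by
      calc b ^ ((2 - T⁻¹) * A.card) ≤ max 1 b ^ ((2 - T⁻¹) * A.card) :=
            Real.rpow_le_rpow hb0.le (le_max_right _ _)
              (mul_nonneg (by linarith) (Nat.cast_nonneg _))
        _ ≤ max 1 b ^ ((2 : ℝ) * A.card) := by
            refine Real.rpow_le_rpow_of_exponent_le (le_max_left _ _) ?_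
            gcongr
            linarith
        _ = (max 1 b ^ 2) ^ A.card := by
            rw [Real.rpow_mul (by positivity), Real.rpow_natCast, Real.rpow_two]
    calc _ ≤ (max 1 b ^ 2) ^ A.card * ((2 * Real.exp 3 * T) ^ A.card / Real.exp T) := by gcongr
      _ = _ := by ring
  have hS' : 0 ≤ S * m.toReal * Real.exp (-(3 * T)) := by positivity
  have hfin := h.trans (add_le_add (add_le_add h1 h2) (ENNReal.ofReal_le_ofReal h3))
  rw [← ENNReal.ofReal_add (by positivity) hS', ← ENNReal.ofReal_add (by positivity)
    (by positivity)] at hfin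
  exact ENNReal.toReal_le_of_le_ofReal (by positivity) hfin

/-- All three terms of `holeProb_le` are absorbed into a constant times `e^{-T} (C T³)^N`.
Positivity of the hole probability is assumed because `Real.log 0 = 0`; the lower bound supplies it.
-/
lemma sub_le_neg_log_holeProb [IsProbabilityMeasure μ]
    (ha : ∀ z : ℂ, Summable fun n => a n * z ^ n) (ha0 : a 0 ≠ 0) (hm : ∀ n, Measurable (ξ n))
    (hind : iIndepFun ξ μ) (hlaw : ∀ n, μ.map (ξ n) = stdComplexGaussian) {r : ℝ} (hr : 0 < r)
    (hT : 1 ≤ holeExponent a r) (hpos : 0 < holeProb μ a ξ r)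
    (hsum : ∑' n : ℕ, ENNReal.ofReal (‖a n‖ * r ^ n)
      ≤ ENNReal.ofReal (7 * holeExponent a r * Real.exp (holeExponent a r))) :
    holeExponent a r - Real.log (3 + 7 * (∫⁻ z, ‖z‖ₑ ∂stdComplexGaussian).toReal)
      - (dominantIndices a r).card * (Real.log (max 1 (2 * ‖a 0‖) ^ 2 * (2 * Real.exp 3))
        + 3 * Real.log (holeExponent a r))
      ≤ -Real.log (holeProb μ a ξ r) := by
  set T := holeExponent a r with hTdef
  set N := (dominantIndices a r).card with hN
  set m := (∫⁻ z, ‖z‖ₑ ∂stdComplexGaussian).toReal with hmdef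
  have hm0 : 0 ≤ m := ENNReal.toReal_nonneg
  have hT0 : 0 < T := by linarith
  have h := holeProb_le ha ha0 hm hind hlaw hr hT (by positivity) hsum
  rw [← hTdef, ← hN, ← hmdef] at h
  set C := max 1 (2 * ‖a 0‖) ^ 2 * (2 * Real.exp 3) with hC
  have hmax1 : 1 ≤ max 1 (2 * ‖a 0‖) := le_max_left _ _
  have hC1 : 1 ≤ C := by
    have h3 : 1 ≤ Real.exp 3 := Real.one_le_exp (by norm_num)
    have : 1 ≤ max 1 (2 * ‖a 0‖) ^ 2 := one_le_pow₀ hmax1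
    nlinarith
  have hQ : max 1 (2 * T * ‖a 0‖) ^ 2 * (2 * Real.exp 3 * T) ≤ C * T ^ 3 := by
    have h1 : max 1 (2 * T * ‖a 0‖) ≤ max 1 (2 * ‖a 0‖) * T := by
      refine max_le (one_le_mul_of_one_le_of_one_le hmax1 hT) ?_
      have : 2 * ‖a 0‖ ≤ max 1 (2 * ‖a 0‖) := le_max_right _ _
      nlinarith
    calc _ ≤ (max 1 (2 * ‖a 0‖) * T) ^ 2 * (2 * Real.exp 3 * T) := by gcongr
      _ = C * T ^ 3 := by rw [hC]; ring
  have hCT : 1 ≤ C * T ^ 3 := one_le_mul_of_one_le_of_one_le hC1 (one_le_pow₀ hT)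
  have hmid : 7 * T * Real.exp T * m * Real.exp (-(3 * T)) ≤ 7 * m * Real.exp (-T) := by
    have h1 : T * Real.exp (-(3 * T)) * Real.exp T ≤ Real.exp (-T) := by
      have h2 : T ≤ Real.exp T := by linarith [Real.add_one_le_exp T]
      calc T * Real.exp (-(3 * T)) * Real.exp T ≤ Real.exp T * Real.exp (-(3 * T)) * Real.exp T := by
            gcongr
        _ = Real.exp (-T) := by rw [← Real.exp_add, ← Real.exp_add]; congr 1; ring
    calc _ = 7 * m * (T * Real.exp (-(3 * T)) * Real.exp T) := by ring
      _ ≤ _ := by gcongr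
  have hpow : 1 ≤ (C * T ^ 3) ^ N := one_le_pow₀ hCT
  have hle : holeProb μ a ξ r ≤ (3 + 7 * m) * Real.exp (-T) * (C * T ^ 3) ^ N := by
    have h1 : (max 1 (2 * T * ‖a 0‖) ^ 2 * (2 * Real.exp 3 * T)) ^ N ≤ (C * T ^ 3) ^ N := by
      gcongr
    have hE : 0 < Real.exp (-T) := Real.exp_pos _
    calc holeProb μ a ξ r ≤ 2 * Real.exp (-T) + 7 * m * Real.exp (-T)
          + Real.exp (-T) * (C * T ^ 3) ^ N := by
          refine h.trans ?_
          gcongr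
      _ = (2 + 7 * m) * Real.exp (-T) * 1 + Real.exp (-T) * (C * T ^ 3) ^ N := by ring
      _ ≤ (2 + 7 * m) * Real.exp (-T) * (C * T ^ 3) ^ N + Real.exp (-T) * (C * T ^ 3) ^ N := by
          gcongr
      _ = _ := by ring
  have hlog := Real.log_le_log hpos hle
  rw [Real.log_mul (by positivity) (by positivity), Real.log_mul (by positivity) (by positivity),
    Real.log_exp, Real.log_pow, Real.log_mul (by positivity) (by positivity), Real.log_pow] at hlog
  push_cast at hlog
  linarith

/-- The two-sided bound at a fixed radius outside the exceptional set. -/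
lemma abs_neg_log_holeProb_sub_le [IsProbabilityMeasure μ]
    (ha : ∀ z : ℂ, Summable fun n => a n * z ^ n) (ha0 : a 0 ≠ 0) (hm : ∀ n, Measurable (ξ n))
    (hind : iIndepFun ξ μ) (hlaw : ∀ n, μ.map (ξ n) = stdComplexGaussian) {ε : ℝ} (hε0 : 0 < ε)
    (hε1 : ε < 1 / 2) :
    ∃ C : ℝ, ∀ r : ℝ, 1 ≤ r → 1 ≤ holeExponent a r →
      r ∉ borelExceptionalSet (holeExponent a) (ε / 2) →
      |-Real.log (holeProb μ a ξ r) - holeExponent a r| ≤ C * holeExponent a r ^ (1 / 2 + ε) := by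
  set m := (∫⁻ z, ‖z‖ₑ ∂stdComplexGaussian).toReal with hmdef
  have hm0 : 0 ≤ m := ENNReal.toReal_nonneg
  have hmtop : ∫⁻ z, ‖z‖ₑ ∂stdComplexGaussian = ENNReal.ofReal m :=
    (ENNReal.ofReal_toReal lintegral_enorm_stdComplexGaussian_lt_top.ne).symm
  have ha0' : 0 < ‖a 0‖ := norm_pos_iff.2 ha0
  set η := ε / 2 with hη
  have hη0 : 0 < η := by positivity
  set D := Real.log (max 1 (2 * ‖a 0‖) ^ 2 * (2 * Real.exp 3)) with hD
  have hD0 : 0 ≤ D := by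
    refine Real.log_nonneg (one_le_mul_of_one_le_of_one_le (one_le_pow₀ (le_max_left _ _)) ?_)
    linarith [Real.one_le_exp (show (0 : ℝ) ≤ 3 by norm_num)]
  set C₁ := ((4 + 8 * m) / ‖a 0‖ + 2) ^ 2 + 3 * (2 / η + 2) + 1 with hC₁
  set C₂ := Real.log (3 + 7 * m) + 3 * (D + 3 / η) with hC₂
  have hlog37 : 0 ≤ Real.log (3 + 7 * m) := Real.log_nonneg (by linarith)
  refine ⟨max C₁ C₂, fun r hr hT hrE => ?_⟩
  obtain ⟨B, hBsub, hBcard, hBtail⟩ :=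
    exists_finset_of_notMem_borelExceptionalSet ha hη0 hr hT hrE
  set T := holeExponent a r with hTdef
  have hT0 : 0 < T := by linarith
  have hr0 : 0 < r := by linarith
  set W := T ^ (1 / 2 + ε) with hW
  set P := T ^ ((1 + η) / 2) with hP
  have hP0 : 0 < P := by positivity
  have hTη1 : 1 ≤ T ^ η := Real.one_le_rpow hT hη0.le
  -- The exponents fit: `(1 + η)/2 + η = 1/2 + 3ε/4`. The spare factor `T ^ η` pays for `log T`.
  have hPW : P * T ^ η ≤ W := by
    rw [hP, hW, ← Real.rpow_add hT0]
    exact Real.rpow_le_rpow_of_exponent_le hT (by rw [hη]; linarith)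
  have hηW : (T ^ η) ^ 2 ≤ W := by
    rw [hW, ← Real.rpow_natCast, ← Real.rpow_mul hT0.le]
    exact Real.rpow_le_rpow_of_exponent_le hT (by rw [hη]; push_cast; linarith)
  have hW1 : 1 ≤ W := Real.one_le_rpow hT (by linarith)
  have hPT : P ≤ T := by
    have := Real.rpow_le_rpow_of_exponent_le hT (show (1 + η) / 2 ≤ 1 by rw [hη]; linarith)
    rwa [Real.rpow_one] at this
  have hηT : T ^ η ≤ T := by
    have := Real.rpow_le_rpow_of_exponent_le hT (show η ≤ 1 by rw [hη]; linarith)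
    rwa [Real.rpow_one] at this
  have hlogT : Real.log T ≤ T ^ η / η := Real.log_le_rpow_div hT0.le hη0
  have hlogT0 : 0 ≤ Real.log T := Real.log_nonneg hT
  -- the bound from below for the hole probability
  set t := ((4 + 8 * m) / ‖a 0‖) * T ^ η with ht
  have hupper := neg_log_holeProb_le ha hm hind hlaw hr0.le B (K := 8 * m * T ^ η + 1) (q := T)
    (t := t) (by positivity) hT (by positivity)
    (by
      rw [hmtop]
      refine (mul_le_mul_left hBtail _).trans ?_
      rw [← ENNReal.ofReal_mul (by positivity)]
      refine ENNReal.ofReal_le_ofReal ?_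
      linarith)
    (by
      have h1 : (B.card : ℝ) / T ≤ 3 := by
        rw [div_le_iff₀ hT0]
        linarith
      have h2 : ‖a 0‖ * t = (4 + 8 * m) * T ^ η := by
        rw [ht]; field_simp
      rw [h2]
      nlinarith)
  obtain ⟨hpos, hupper⟩ := hupper
  -- the bound from above
  have hlower := sub_le_neg_log_holeProb ha ha0 hm hind hlaw hr0 hT hpos (by
    refine (tsum_ofReal_le_of_finset ha hr0.le (by positivity) hBtail).trans
      (ENNReal.ofReal_le_ofReal ?_)
    have h1 : 1 ≤ Real.exp (holeExponent a r) := Real.one_le_exp hT0.le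
    have h2 : (B.card : ℝ) * Real.exp (holeExponent a r) ≤ 3 * T * Real.exp (holeExponent a r) := by
      gcongr
      linarith
    have h3 : 4 * holeExponent a r ^ η ≤ 4 * T * Real.exp (holeExponent a r) := by
      rw [← hTdef]
      nlinarith
    rw [← hTdef] at h2 h3 ⊢
    linarith)
  rw [← hTdef, ← hmdef, ← hD] at hlower
  have hcardA : ((dominantIndices a r).card : ℝ) ≤ 3 * P :=
    le_trans (by exact_mod_cast Finset.card_le_card hBsub) hBcard
  rw [abs_le]
  constructor
  · have h1 : ((dominantIndices a r).card : ℝ) * (D + 3 * Real.log T) ≤ 3 * (D + 3 / η) * W := by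
      calc ((dominantIndices a r).card : ℝ) * (D + 3 * Real.log T)
          ≤ 3 * P * (D * T ^ η + 3 * (T ^ η / η)) := by
            gcongr
            exact le_mul_of_one_le_right hD0 hTη1
        _ = 3 * (D + 3 / η) * (P * T ^ η) := by ring
        _ ≤ _ := by gcongr
    have h2 : Real.log (3 + 7 * m) ≤ Real.log (3 + 7 * m) * W := le_mul_of_one_le_right hlog37 hW1
    have h3 : C₂ * W ≤ max C₁ C₂ * W := by
      gcongr
      exact le_max_right _ _
    have h4 : C₂ * W = Real.log (3 + 7 * m) * W + 3 * (D + 3 / η) * W := by rw [hC₂]; ring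
    linarith
  · have h1 : (B.card : ℝ) * (2 * Real.log T + 2) ≤ 3 * (2 / η + 2) * W := by
      calc (B.card : ℝ) * (2 * Real.log T + 2)
          ≤ 3 * P * (2 * (T ^ η / η) + 2 * T ^ η) := by
            gcongr
            linarith
        _ = 3 * (2 / η + 2) * (P * T ^ η) := by ring
        _ ≤ _ := by gcongr
    have h2 : (t + 2) ^ 2 ≤ ((4 + 8 * m) / ‖a 0‖ + 2) ^ 2 * W := by
      have h5 : t + 2 ≤ ((4 + 8 * m) / ‖a 0‖ + 2) * T ^ η := by
        rw [ht, add_mul]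
        linarith
      calc (t + 2) ^ 2 ≤ (((4 + 8 * m) / ‖a 0‖ + 2) * T ^ η) ^ 2 := by gcongr
        _ = ((4 + 8 * m) / ‖a 0‖ + 2) ^ 2 * (T ^ η) ^ 2 := by ring
        _ ≤ _ := by gcongr
    have h3 : C₁ * W ≤ max C₁ C₂ * W := by
      gcongr
      exact le_max_left _ _
    have h4 : C₁ * W = ((4 + 8 * m) / ‖a 0‖ + 2) ^ 2 * W + 3 * (2 / η + 2) * W + W := by
      rw [hC₁]; ring
    linarith

end Asymptotics

theorem mainTheorem5 (a : ℕ → ℂ) (ha0 : a 0 ≠ 0)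
    (hentire : ∀ z : ℂ, Summable fun n => a n * z ^ n)
    (hnonconst : ¬ ∃ c : ℂ, ∀ z : ℂ, ∑' n, a n * z ^ n = c)
    (ε : ℝ) (hε : ε ∈ Set.Ioo (0 : ℝ) (1 / 2)) :
    ∃ E : Set ℝ, HasFiniteLogMeasure E ∧
      ∀ (Ω : Type*) [MeasurableSpace Ω] (μ : Measure Ω) [IsProbabilityMeasure μ]
        (ξ : ℕ → Ω → ℂ), (∀ n, Measurable (ξ n)) → iIndepFun ξ μ →
        (∀ n, μ.map (ξ n) = stdComplexGaussian) →
        (∀ᵐ ω ∂μ, ∀ z : ℂ, Summable fun n => a n * ξ n ω * z ^ n) ∧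
        (fun r : ℝ => -Real.log (holeProb μ a ξ r) - holeExponent a r)
          =O[atTop ⊓ 𝓟 Eᶜ] fun r : ℝ => holeExponent a r ^ (1 / 2 + ε) := by
  refine ⟨borelExceptionalSet (holeExponent a) (ε / 2),
    hasFiniteLogMeasure_borelExceptionalSet _ (half_pos hε.1), ?_⟩
  intro Ω _ μ _ ξ hm hind hlaw
  refine ⟨ae_summable_randomTaylor hentire hm hlaw, ?_⟩
  obtain ⟨C, hC⟩ := abs_neg_log_holeProb_sub_le hentire ha0 hm hind hlaw hε.1 hε.2
  refine IsBigO.of_bound C ?_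
  rw [eventually_inf_principal]
  filter_upwards [eventually_ge_atTop 1,
    (tendsto_holeExponent hentire hnonconst).eventually_ge_atTop 1] with r hr hT hrE
  rw [Real.norm_eq_abs, Real.norm_eq_abs,
    abs_of_nonneg (Real.rpow_nonneg (by linarith : (0 : ℝ) ≤ holeExponent a r) _)]
  exact hC r hr hT hrE
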